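/- Let $F_0$ be a non-Archimedean local field of characteristic not two with ring of integers $O_{F_0}$, let $F/F_0$ be a finite separable field extension with ring of integers $O_F$, and let $\pi$ be a uniformizer of $O_F$. Let $B$ be a division quaternion algebra over $F$ (a central division $F$-algebra of dimension $4$) with canonical involution $\bar b=\mathrm{Tr}_{B/F}(b)-b$, where $\mathrm{Tr}_{B/F}$ is the reduced trace. Let $*$ be an orthogonal involution of the first kind on $B$, and let $\gamma\in B^\times$ be an element with $\bar\gamma+\gamma=0$ and $b^*=\gamma\bar b\gamma^{-1}$ for all $b\in B$. Let $O_B$ be the maximal $O_F$-order of $B$ (it is stable under $*$), let $\Pi$ be a uniformizer of $O_B$ with $\Pi\bar\Pi=\pi$, and let $\mathrm{ord}:B^\times\to\mathbb Z$ be the valuation with $\mathrm{ord}(\Pi)=1$. An $F_0$-valued skew-Hermitian $(B,*)$-module is a pair $(V,\psi)$, where $V$ is a finite free left $B$-module and $\psi:V\times V\to F_0$ is a non-degenerate $F_0$-bilinear pairing such that $\psi(y,x)=-\psi(x,y)$ and $\psi(ax,y)=\psi(x,a^*y)$ for all $a\in B$ and $x,y\in V$; isomorphisms are $B$-linear bijections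 preserving the pairings. An $(O_B,*)$-lattice in $(V,\psi)$ is a finite free left $O_B$-submodule $\Lambda\subset V$ with $B\Lambda=V$; its rank is that of $V$, its dual is $\Lambda^{\vee,\psi}=\{x\in V\mid \psi(x,\Lambda)\subset O_{F_0}\}$, and isomorphisms of lattices are $O_B$-linear bijections preserving the restrictions of the pairings. Let $n\ge 1$. Then: (1) There exists an $F_0$-valued skew-Hermitian $(B,*)$-module $(V,\psi)$ of rank $n$, and it is unique up to isomorphism. (2) For every integer $i$, there exists an $(O_B,*)$-lattice $\Lambda$ in $(V,\psi)$ with $\Lambda=\Pi^i\Lambda^{\vee,\psi}$ if and only if $n$ is even or $i+\mathrm{ord}(\gamma)$ is odd. (3) For every integer $i$, any two $(O_B,*)$-lattices $\Lambda$ of rank $n$ with $\Lambda=\Pi^i\Lambda^{\vee,\psi}$ are isomorphic. -/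

import Mathlib

open scoped ValuativeRel

universe u₀ u v w

namespace QuatLattice

section Field

variable (F₀ : Type u₀) [Field F₀] [ValuativeRel F₀] (F : Type u) [Field F] [Algebra F₀ F]

/-- The ring of integers of a finite extension `F` of the local field `F₀`: the integral closure
in `F` of the ring of integers of `F₀`. -/
noncomputable abbrev ringOfIntegers : Subalgebra 𝒪[F₀] F := integralClosure 𝒪[F₀] F

end Field

section Quaternion

variable (F : Type u) [Field F] {B : Type v} [DivisionRing B] [Algebra F B]

/-- The reduced trace of a quaternion algebra `B` over a field `F` of characteristic not two. The
trace of left multiplication by `b` on the four-dimensional space `B` is twice the reduced trace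
of `b`. -/
noncomputable def reducedTrace (b : B) : F :=
  LinearMap.trace F B (LinearMap.mulLeft F b) / 2

/-- The canonical involution `b ↦ Trd(b) - b` of a quaternion algebra. -/
noncomputable def conj (b : B) : B := algebraMap F B (reducedTrace F b) - b

variable {F}

/-- `σ` is an orthogonal involution of the first kind of the quaternion algebra `B` over a field
`F` of characteristic not two: an `F`-linear anti-automorphism of order at most two whose space of
symmetric elements has dimension `d (d + 1) / 2 = 3`, where `d = 2` is the degree of `B`
(for a symplectic involution the dimension is `d (d - 1) / 2 = 1`). -/
structure IsOrthogonalInvolution (σ : B →ₗ[F] B) : Prop where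
  map_mul : ∀ a b : B, σ (a * b) = σ b * σ a
  involutive : ∀ a : B, σ (σ a) = a
  orthogonal : Module.finrank F (LinearMap.ker (σ - LinearMap.id)) = 3

/-- `γ` is an invertible element with `γ̄ + γ = 0` that represents the involution `σ` as
`b ↦ γ b̄ γ⁻¹`. -/
structure Represents (σ : B →ₗ[F] B) (γ : B) : Prop where
  ne_zero : γ ≠ 0
  conj_add : conj F γ + γ = 0
  apply_eq : ∀ b : B, σ b = γ * conj F b * γ⁻¹

end Quaternion

section Order

variable {F : Type u} [Field F] {B : Type v} [DivisionRing B] [Algebra F B]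
  {R : Type*} [CommRing R] [Algebra R B]

/-- An `R`-order in the `F`-algebra `B`: an `R`-subalgebra which is finitely generated as an
`R`-module and spans `B` over `F`. -/
def IsOrder (F : Type u) [Field F] [Algebra F B] (O : Subalgebra R B) : Prop :=
  Module.Finite R O ∧ Submodule.span F (O : Set B) = ⊤

/-- A maximal `R`-order in the `F`-algebra `B`. -/
def IsMaximalOrder (F : Type u) [Field F] [Algebra F B] (O : Subalgebra R B) : Prop :=
  Maximal (fun O' : Subalgebra R B => IsOrder F O') O

/-- `P` is a uniformizer of `O`, the maximal order of a division algebra over a local field: it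
generates the maximal ideal of `O`, which consists of the non-units. -/
def IsUniformizer (O : Subalgebra R B) (P : B) : Prop :=
  ∃ hP : P ∈ O, ∀ b : O, ¬ IsUnit b ↔ ∃ c : O, b = ⟨P, hP⟩ * c

/-- The valuation on `B` attached to its maximal order `O`, normalized to be `1` at the
uniformizer `P`: for `b ≠ 0` it is the largest integer `k` with `b ∈ P ^ k O`. -/
noncomputable def ord (O : Subalgebra R B) (P b : B) : ℤ :=
  sSup {k : ℤ | ∃ c ∈ O, b = P ^ k * c}

end Order

section Module

variable (F₀ : Type u₀) [Field F₀] {F : Type u} [Field F]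
  {B : Type v} [DivisionRing B] [Algebra F B] [Algebra F₀ B]

/-- An `F₀`-valued skew-Hermitian `(B, σ)`-module: a finite free left `B`-module `V` with a
non-degenerate `F₀`-bilinear form `ψ : V × V → F₀` such that `ψ (y, x) = - ψ (x, y)` and
`ψ (a x, y) = ψ (x, σ(a) y)`. -/
structure SkewHermitianModule (σ : B →ₗ[F] B) where
  V : Type w
  [addCommGroup : AddCommGroup V]
  [moduleB : Module B V]
  [moduleF₀ : Module F₀ V]
  [isScalarTower : IsScalarTower F₀ B V]
  [finite : Module.Finite B V]
  [free : Module.Free B V]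
  ψ : V →ₗ[F₀] V →ₗ[F₀] F₀
  nondegenerate : ψ.Nondegenerate
  skew : ∀ x y : V, ψ y x = - ψ x y
  adjoint : ∀ (a : B) (x y : V), ψ (a • x) y = ψ x (σ a • y)

attribute [instance] SkewHermitianModule.addCommGroup SkewHermitianModule.moduleB
  SkewHermitianModule.moduleF₀ SkewHermitianModule.isScalarTower SkewHermitianModule.finite
  SkewHermitianModule.free

namespace SkewHermitianModule

variable {F₀} {σ : B →ₗ[F] B}

/-- The rank of the `B`-module `V`. -/
noncomputable def rank (M : SkewHermitianModule.{u₀, u, v, w} F₀ σ) : ℕ := Module.finrank B M.V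

/-- Isomorphism of skew-Hermitian modules: a `B`-linear bijection preserving the forms. -/
def Isomorphic (M : SkewHermitianModule.{u₀, u, v, w} F₀ σ)
    (M' : SkewHermitianModule.{u₀, u, v, w} F₀ σ) : Prop :=
  ∃ f : M.V ≃ₗ[B] M'.V, ∀ x y : M.V, M'.ψ (f x) (f y) = M.ψ x y

variable {R : Type*} [CommRing R] [Algebra R B] {O : Subalgebra R B}

/-- An `(O, σ)`-lattice in `(V, ψ)`: a finite free left `O`-submodule `L` of `V` with
`B L = V`. -/
structure IsLattice (M : SkewHermitianModule.{u₀, u, v, w} F₀ σ) (L : Submodule O M.V) : Prop where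
  finite : Module.Finite O L
  free : Module.Free O L
  span_eq_top : Submodule.span B (L : Set M.V) = ⊤

/-- The dual lattice `{x ∈ V | ψ(x, L) ⊆ O_{F₀}}`. -/
def dual [ValuativeRel F₀] (M : SkewHermitianModule.{u₀, u, v, w} F₀ σ) (L : Submodule O M.V) :
    Set M.V :=
  {x | ∀ y ∈ L, M.ψ x y ∈ 𝒪[F₀]}

/-- `L` is a lattice in `(V, ψ)` with `L = P ^ i L^∨`. -/
structure IsScaledSelfDual [ValuativeRel F₀] (M : SkewHermitianModule.{u₀, u, v, w} F₀ σ)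
    (P : B) (i : ℤ) (L : Submodule O M.V) : Prop where
  isLattice : M.IsLattice L
  eq_dual : (L : Set M.V) = (fun x : M.V => P ^ i • x) '' M.dual L

/-- Isomorphism of lattices in skew-Hermitian modules: an `O`-linear bijection preserving the
restrictions of the forms. -/
def LatticeIsomorphic (M M' : SkewHermitianModule.{u₀, u, v, w} F₀ σ)
    (L : Submodule O M.V) (L' : Submodule O M'.V) : Prop :=
  ∃ f : L ≃ₗ[O] L', ∀ x y : L, M'.ψ (f x : M'.V) (f y : M'.V) = M.ψ (x : M.V) (y : M.V)

end SkewHermitianModule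

end Module

end QuatLattice

/-! Let `T = Tr_{F/F₀} ∘ Trd`. Every form `ψ` can be written `ψ(x,y) = T(h(x,y)γ⁻¹)` for a unique
`B`-valued `h`, and the relation `γ̄ = -γ` turns the skew symmetry of `ψ` into hermitian symmetry of
`h` for the canonical involution (`exists_isHermitian`, `ofIsHermitian`). So the theorem concerns
nondegenerate hermitian forms over `(B, ¯)`. Their values `h(x,x)` lie in `F`, and `Nrd : B^× → F^×`
is surjective, so each such form has an orthonormal basis (`exists_orthonormal_basis`). This gives
existence and uniqueness in every rank.

For lattices, let `π^e O_F` be the inverse different of `F/F₀`. The `T`-dual of `O` is `P^(2e-1) O`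
(`exists_totalTrace_mem_iff`), hence `Λ = P^i Λ^∨` means that `Λ` is `P^m`-modular for `h` with `m =
i + ord γ + 2e - 1` (`isScaledSelfDual_iff`). If `m = 2k`, vectors with `h(x,x)` of exact order `m`
split off, and unit norms normalize them to `π^k` (`IsModular.exists_basis_of_even`). If `m` is odd,
`h(x,x)`, being central, has even order and thus lies in `P^(m+1) O`; then only hyperbolic planes
split off, and the rank is even (`IsModular.exists_basis_of_odd`). The Gram matrix depends only on
`m` and the rank, which gives uniqueness. Existence follows by rescaling an orthonormal basis or
pairing its vectors into hyperbolic planes.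

The arithmetic input is collected in `IsLocalOrder`: an integral element of trace one, unit norms,
and solvability of `t + πct² = s`. It comes from the residue extension and adic completeness. -/

namespace QuatLattice

/-! ### Reduced trace, reduced norm and involutions of quaternion algebras. -/

section QuaternionAlgebra

variable {F : Type u} [Field F] {B : Type v} [DivisionRing B] [Algebra F B]

theorem exists_algebraMap_eq_of_forall_commute [Algebra.IsCentral F B] {b : B}
    (h : ∀ z, z * b = b * z) : ∃ c : F, algebraMap F B c = b := by
  have : b ∈ Subalgebra.center F B := Subalgebra.mem_center_iff.2 h
  exact Algebra.mem_bot.1 (Algebra.IsCentral.out this)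

/-- Every element of a four-dimensional central division algebra is quadratic. -/
theorem exists_quadratic [Algebra.IsCentral F B] (hB : Module.finrank F B = 4) (b : B) :
    ∃ s n : F, b * b = algebraMap F B s * b - algebraMap F B n := by
  have : FiniteDimensional F B := FiniteDimensional.of_finrank_pos (by omega)
  by_cases hb : ∃ c, algebraMap F B c = b
  · obtain ⟨c, rfl⟩ := hb
    exact ⟨c, 0, by simp⟩
  let S := Algebra.adjoin F {b}
  have hbS : b ∈ S := Algebra.self_mem_adjoin_singleton F b
  -- By the tower law the degree of `F[b]` divides 4. It is neither 1 nor 4 because `b` is not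
  -- central, so `1, b` is a basis of `F[b]`.
  have hmul : Module.finrank F S * Module.finrank S B = 4 := by
    let _ : DivisionRing S := divisionRingOfFiniteDimensional F S
    rw [← hB]
    exact Module.finrank_mul_finrank F S B
  have h1 : Module.finrank F S ≠ 1 := fun h => by
    rw [Subalgebra.finrank_eq_one_iff] at h
    exact hb (Algebra.mem_bot.1 (h ▸ hbS))
  have h4 : Module.finrank F S ≠ 4 := fun h => by
    have htop : S = ⊤ := Subalgebra.eq_of_le_of_finrank_le le_top (by
      rw [h, ← hB]; exact (Subalgebra.topEquiv (R := F) (A := B)).toLinearEquiv.finrank_eq.le)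
    refine hb (exists_algebraMap_eq_of_forall_commute fun z => ?_)
    have hz : z ∈ S := htop ▸ Algebra.mem_top
    exact (Algebra.commute_of_mem_adjoin_of_forall_mem_commute hz (by simp)).symm
  have h2 : Module.finrank F S = 2 := by
    have hle : Module.finrank F S ∣ 4 := ⟨_, hmul.symm⟩
    have := Nat.le_of_dvd (by norm_num) hle
    interval_cases Module.finrank F S <;> simp_all
  let x : S := ⟨b, hbS⟩
  have hli : LinearIndependent F ![(1 : S), x] := by
    rw [LinearIndependent.pair_iff' one_ne_zero]
    intro a ha
    exact hb ⟨a, by simpa [x, Algebra.algebraMap_eq_smul_one] using congrArg Subtype.val ha⟩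
  have hspan := hli.span_eq_top_of_card_eq_finrank' (by simp [h2])
  have hx : x * x ∈ Submodule.span F (Set.range ![(1 : S), x]) := hspan ▸ Submodule.mem_top
  rw [Matrix.range_cons, Matrix.range_cons, Matrix.range_empty, Set.union_empty,
    Set.singleton_union, Submodule.mem_span_pair] at hx
  obtain ⟨n, s, hns⟩ := hx
  refine ⟨s, -n, ?_⟩
  have := congrArg Subtype.val hns
  simp only [x, Subalgebra.coe_add, Subalgebra.coe_mul, Algebra.smul_def, mul_one,
    Subalgebra.coe_algebraMap] at this
  rw [← this, map_neg]; abel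

theorem reducedTrace_add (a b : B) :
    reducedTrace F (a + b) = reducedTrace F a + reducedTrace F b := by
  have : LinearMap.mulLeft F (a + b) = LinearMap.mulLeft F a + LinearMap.mulLeft F b := by
    ext x; simp [add_mul]
  simp [reducedTrace, this, add_div]

theorem reducedTrace_smul (c : F) (b : B) :
    reducedTrace F (c • b) = c * reducedTrace F b := by
  have : LinearMap.mulLeft F (c • b) = c • LinearMap.mulLeft F b := by
    ext x; simp
  simp [reducedTrace, this, mul_div_assoc]

theorem reducedTrace_mul_comm (a b : B) :
    reducedTrace F (a * b) = reducedTrace F (b * a) := by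
  simp only [reducedTrace, LinearMap.mulLeft_mul]
  exact congrArg (· / 2) (LinearMap.trace_mul_comm F (LinearMap.mulLeft F a) (LinearMap.mulLeft F b))

variable (F B) in
/-- The reduced trace as a linear map. -/
noncomputable def reducedTraceLinear : B →ₗ[F] F where
  toFun := reducedTrace F
  map_add' := reducedTrace_add
  map_smul' c b := reducedTrace_smul c b

theorem reducedTrace_algebraMap (h2 : (2 : F) ≠ 0) (hB : Module.finrank F B = 4) (c : F) :
    reducedTrace F (algebraMap F B c) = 2 * c := by
  have : FiniteDimensional F B := FiniteDimensional.of_finrank_pos (by omega)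
  have h1 : reducedTrace F (1 : B) = 2 := by
    rw [reducedTrace, LinearMap.mulLeft_one, LinearMap.trace_id, hB, div_eq_iff h2]
    norm_num
  rw [Algebra.algebraMap_eq_smul_one, reducedTrace_smul, h1, mul_comm]

/-- An element whose square is central and which is not central has trace zero. -/
theorem reducedTrace_eq_zero_of_sq [Algebra.IsCentral F B] (h2 : (2 : F) ≠ 0)
    {b : B} {d : F} (hd : b * b = algebraMap F B d) (hb : ¬ ∃ c, algebraMap F B c = b) :
    reducedTrace F b = 0 := by
  obtain ⟨z, hz⟩ : ∃ z, z * b ≠ b * z := by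
    by_contra! h
    exact hb (exists_algebraMap_eq_of_forall_commute h)
  have hy0 : b * z - z * b ≠ 0 := fun h => hz (sub_eq_zero.1 h).symm
  -- Since `b²` is central, `b` anticommutes with the commutator `bz - zb`. Thus `b` is conjugate to
  -- `-b`, and its trace is its own negative.
  have hy : b * (b * z - z * b) = -((b * z - z * b) * b) := by
    rw [mul_sub, sub_mul, ← mul_assoc, hd, mul_assoc z b b, hd, Algebra.commutes d z, mul_assoc]
    abel
  have key : (b * z - z * b)⁻¹ * (b * (b * z - z * b)) = -b := by
    rw [hy, mul_neg, inv_mul_cancel_left₀ hy0]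
  have h := reducedTrace_mul_comm (F := F) (b * z - z * b)⁻¹ (b * (b * z - z * b))
  rw [key, mul_assoc, mul_inv_cancel₀ hy0, mul_one] at h
  have h' : reducedTrace F (-b) = - reducedTrace F b := (reducedTraceLinear F B).map_neg b
  rw [h'] at h
  have : 2 * reducedTrace F b = 0 := by linear_combination -h
  simpa [h2] using this

/-- The quadratic equation of an element with the reduced trace as linear coefficient. -/
theorem exists_mul_self_eq [Algebra.IsCentral F B] (h2 : (2 : F) ≠ 0)
    (hB : Module.finrank F B = 4) (b : B) :
    ∃ n : F, b * b = algebraMap F B (reducedTrace F b) * b - algebraMap F B n := by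
  by_cases hb : ∃ c, algebraMap F B c = b
  · obtain ⟨c, rfl⟩ := hb
    refine ⟨c * c, ?_⟩
    rw [reducedTrace_algebraMap h2 hB, ← map_mul, ← map_mul, ← map_sub]
    congr 1; ring
  obtain ⟨s, n, hsn⟩ := exists_quadratic hB b
  have hs : reducedTrace F b = s := by
    -- Completing the square: `b - s/2` is noncentral with central square `s²/4 - n`.
    have h0 : reducedTrace F (b - algebraMap F B (s / 2)) = 0 := by
      refine reducedTrace_eq_zero_of_sq (d := s ^ 2 / 4 - n) h2 ?_ ?_
      · have hc := Algebra.commutes (s / 2) b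
        have hss : algebraMap F B s = algebraMap F B (s / 2) + algebraMap F B (s / 2) := by
          rw [← map_add]; congr 1; field_simp; norm_num
        have h4 : algebraMap F B (s ^ 2 / 4) = algebraMap F B (s / 2) * algebraMap F B (s / 2) := by
          rw [← map_mul]; congr 1
          have : (4 : F) = 2 * 2 := by norm_num
          rw [this]; field_simp
        rw [sub_mul, mul_sub, mul_sub, hsn, hss, map_sub, h4, ← hc, add_mul]
        abel
      · rintro ⟨c, hc⟩
        exact hb ⟨c + s / 2, by rw [map_add, hc]; abel⟩
    have h1 := (reducedTraceLinear F B).map_sub b (algebraMap F B (s / 2))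
    change reducedTrace F _ = reducedTrace F _ - reducedTrace F _ at h1
    rw [h0, reducedTrace_algebraMap h2 hB] at h1
    have : 2 * (s / 2) = s := by field_simp
    rw [this] at h1
    exact (sub_eq_zero.1 h1.symm)
  exact ⟨n, hs ▸ hsn⟩

/-- The reduced norm of a quaternion algebra. -/
noncomputable def reducedNorm (F : Type u) [Field F] {B : Type v} [DivisionRing B] [Algebra F B]
    (b : B) : F :=
  (reducedTrace F b ^ 2 - reducedTrace F (b * b)) / 2

/-- The identities of the canonical involution of a quaternion algebra. -/
structure IsQuaternion (F : Type u) [Field F] (B : Type v) [DivisionRing B] [Algebra F B] :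
    Prop where
  two_ne_zero : (2 : F) ≠ 0
  reducedTrace_algebraMap : ∀ c : F, reducedTrace F (algebraMap F B c) = 2 * c
  mul_self_eq : ∀ b : B, b * b = algebraMap F B (reducedTrace F b) * b
    - algebraMap F B (reducedNorm F b)

theorem isQuaternion [Algebra.IsCentral F B] (h2 : (2 : F) ≠ 0)
    (hB : Module.finrank F B = 4) : IsQuaternion F B where
  two_ne_zero := h2
  reducedTrace_algebraMap := reducedTrace_algebraMap h2 hB
  mul_self_eq b := by
    obtain ⟨n, hn⟩ := exists_mul_self_eq h2 hB b
    have : reducedNorm F b = n := by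
      have h := congrArg (reducedTraceLinear F B) hn
      rw [map_sub] at h
      change reducedTrace F _ = reducedTrace F _ - reducedTrace F _ at h
      rw [← Algebra.smul_def, reducedTrace_smul, reducedTrace_algebraMap h2 hB] at h
      rw [reducedNorm, h, div_eq_iff h2]; ring
    rw [this]; exact hn

theorem reducedTrace_sub (a b : B) :
    reducedTrace F (a - b) = reducedTrace F a - reducedTrace F b :=
  (reducedTraceLinear F B).map_sub a b

theorem reducedTrace_neg (a : B) : reducedTrace F (-a) = - reducedTrace F a :=
  (reducedTraceLinear F B).map_neg a

theorem reducedTrace_zero : reducedTrace F (0 : B) = 0 :=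
  (reducedTraceLinear F B).map_zero

theorem conj_add (a b : B) : conj F (a + b) = conj F a + conj F b := by
  simp only [conj, reducedTrace_add, map_add]; abel

theorem conj_zero : conj F (0 : B) = 0 := by simp [conj, reducedTrace_zero]

theorem conj_smul (c : F) (b : B) : conj F (c • b) = c • conj F b := by
  rw [conj, conj, reducedTrace_smul, smul_sub, map_mul, Algebra.smul_def c (algebraMap F B _)]

variable (F B) in
/-- The canonical involution as a linear map. -/
noncomputable def conjLinear : B →ₗ[F] B where
  toFun := conj F
  map_add' := conj_add
  map_smul' := conj_smul

theorem conj_sub (a b : B) : conj F (a - b) = conj F a - conj F b := (conjLinear F B).map_sub a b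

theorem conj_sum {ι : Type*} (s : Finset ι) (f : ι → B) :
    conj F (∑ i ∈ s, f i) = ∑ i ∈ s, conj F (f i) := map_sum (conjLinear F B) f s

theorem add_conj (b : B) : b + conj F b = algebraMap F B (reducedTrace F b) := by
  simp [conj]

namespace IsQuaternion

variable (q : IsQuaternion F B)
include q

theorem conj_algebraMap (c : F) : conj F (algebraMap F B c) = algebraMap F B c := by
  rw [conj, q.reducedTrace_algebraMap, ← map_sub]; congr 1; ring

theorem conj_one : conj F (1 : B) = 1 := by simpa using q.conj_algebraMap 1

theorem conj_conj (b : B) : conj F (conj F b) = b := by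
  rw [conj, conj, reducedTrace_sub, q.reducedTrace_algebraMap, map_sub, two_mul, map_add]; abel

theorem reducedTrace_conj (b : B) : reducedTrace F (conj F b) = reducedTrace F b := by
  rw [conj, reducedTrace_sub, q.reducedTrace_algebraMap]; ring

theorem mul_conj (b : B) : b * conj F b = algebraMap F B (reducedNorm F b) := by
  rw [conj, mul_sub, q.mul_self_eq, ← Algebra.commutes]; abel

theorem conj_mul_self (b : B) : conj F b * b = algebraMap F B (reducedNorm F b) := by
  rw [conj, sub_mul, q.mul_self_eq]; abel

/-- Polarization of the quadratic equation of `a + b`. It yields the anti-multiplicativity of the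
canonical involution. -/
theorem mul_add_mul_comm (a b : B) : a * b + b * a =
    algebraMap F B (reducedTrace F a) * b + algebraMap F B (reducedTrace F b) * a +
      algebraMap F B (reducedTrace F (a * b) - reducedTrace F a * reducedTrace F b) := by
  have h := q.mul_self_eq (a + b)
  have hn : reducedNorm F (a + b) = reducedNorm F a + reducedNorm F b -
      (reducedTrace F (a * b) - reducedTrace F a * reducedTrace F b) := by
    simp only [reducedNorm, mul_add, add_mul, reducedTrace_add, reducedTrace_mul_comm b a]
    have := q.two_ne_zero
    field_simp; ring
  rw [hn, reducedTrace_add] at h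
  rw [add_mul, mul_add, mul_add, q.mul_self_eq a, q.mul_self_eq b] at h
  simp only [mul_add, add_mul, map_add, map_sub] at h ⊢
  have h' := sub_eq_zero.2 h
  rw [← sub_eq_zero, ← h']
  abel

theorem conj_mul (a b : B) : conj F (a * b) = conj F b * conj F a := by
  have h := q.mul_add_mul_comm a b
  have e : conj F b * conj F a = algebraMap F B (reducedTrace F a * reducedTrace F b)
      - algebraMap F B (reducedTrace F a) * b - algebraMap F B (reducedTrace F b) * a + b * a := by
    rw [conj, conj, sub_mul, mul_sub, mul_sub, ← Algebra.commutes (reducedTrace F a) b,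
      mul_comm (reducedTrace F a), map_mul]
    abel
  rw [e, conj]
  rw [map_sub] at h
  have h' : a * b = algebraMap F B (reducedTrace F a) * b + algebraMap F B (reducedTrace F b) * a +
      (algebraMap F B (reducedTrace F (a * b)) - algebraMap F B (reducedTrace F a * reducedTrace F b))
      - b * a := by rw [← h]; abel
  nth_rw 2 [h']
  abel

theorem reducedNorm_mul (a b : B) :
    reducedNorm F (a * b) = reducedNorm F a * reducedNorm F b := by
  apply (algebraMap F B).injective
  rw [← q.mul_conj, q.conj_mul, map_mul, ← q.mul_conj a, mul_assoc, ← mul_assoc b, q.mul_conj b,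
    Algebra.commutes, mul_assoc]

theorem reducedNorm_algebraMap (c : F) : reducedNorm F (algebraMap F B c) = c * c := by
  apply (algebraMap F B).injective
  rw [← q.mul_conj, q.conj_algebraMap, map_mul]

theorem reducedNorm_one : reducedNorm F (1 : B) = 1 := by
  simpa using q.reducedNorm_algebraMap 1

theorem reducedNorm_conj (b : B) : reducedNorm F (conj F b) = reducedNorm F b := by
  apply (algebraMap F B).injective
  rw [← q.mul_conj, q.conj_conj, q.conj_mul_self]

/-- The reduced norm as a homomorphism. -/
noncomputable def reducedNormHom : B →*₀ F where
  toFun := reducedNorm F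
  map_zero' := by simp [reducedNorm, reducedTrace_zero]
  map_one' := q.reducedNorm_one
  map_mul' := q.reducedNorm_mul

theorem reducedNorm_zpow (b : B) (k : ℤ) : reducedNorm F (b ^ k) = reducedNorm F b ^ k :=
  map_zpow₀ q.reducedNormHom b k

theorem conj_ne_zero {b : B} (hb : b ≠ 0) : conj F b ≠ 0 := fun h => hb <| by
  rw [← q.conj_conj b, h, conj_zero]

theorem reducedNorm_ne_zero {b : B} (hb : b ≠ 0) : reducedNorm F b ≠ 0 := fun h => by
  have := q.mul_conj b
  rw [h, map_zero, mul_eq_zero] at this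
  exact this.elim hb (q.conj_ne_zero hb)

theorem conj_inv (b : B) : conj F b⁻¹ = (conj F b)⁻¹ := by
  rcases eq_or_ne b 0 with rfl | hb
  · simp [conj_zero]
  apply eq_inv_of_mul_eq_one_left
  rw [← q.conj_mul, mul_inv_cancel₀ hb, q.conj_one]

theorem reducedNorm_inv (b : B) : reducedNorm F b⁻¹ = (reducedNorm F b)⁻¹ :=
  map_inv₀ q.reducedNormHom b

theorem reducedNorm_add_algebraMap (b : B) (c : F) :
    reducedNorm F (b + algebraMap F B c) = reducedNorm F b + c * reducedTrace F b + c ^ 2 := by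
  have := q.two_ne_zero
  have e : (b + algebraMap F B c) * (b + algebraMap F B c) =
      b * b + (2 * c) • b + algebraMap F B (c * c) := by
    rw [add_mul, mul_add, mul_add, ← Algebra.commutes c b, Algebra.smul_def, two_mul, map_add,
      add_mul, map_mul]
    abel
  rw [reducedNorm, reducedNorm, e]
  simp only [reducedTrace_add, reducedTrace_smul, q.reducedTrace_algebraMap]
  field_simp
  ring

theorem reducedNorm_smul (c : F) (b : B) : reducedNorm F (c • b) = c ^ 2 * reducedNorm F b := by
  rw [Algebra.smul_def, q.reducedNorm_mul, q.reducedNorm_algebraMap, pow_two]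

theorem exists_algebraMap_eq_of_conj_eq {b : B} (h : conj F b = b) :
    ∃ c : F, algebraMap F B c = b := by
  refine ⟨reducedTrace F b / 2, ?_⟩
  have h1 := add_conj (F := F) b
  rw [h, ← two_mul] at h1
  have h2 : (2 : B) = algebraMap F B 2 := (map_ofNat _ 2).symm
  have h20 : algebraMap F B 2 ≠ 0 := by
    simpa using (map_ne_zero (algebraMap F B)).2 q.two_ne_zero
  apply mul_left_cancel₀ h20
  rw [← map_mul, mul_div_cancel₀ _ q.two_ne_zero, ← h1, h2]

variable {σ : B →ₗ[F] B}

/-- Applying `σ` to the equation of `b` gives a second monic quadratic equation for `σ b`. If the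
linear coefficients differed, subtracting the two would make `σ b`, hence `b`, central. -/
theorem reducedTrace_map (hmul : ∀ a b : B, σ (a * b) = σ b * σ a)
    (hinv : ∀ a : B, σ (σ a) = a) (b : B) : reducedTrace F (σ b) = reducedTrace F b := by
  have hσ1 : σ 1 = 1 := by
    have h1 : σ (σ 1 * 1) = σ 1 * σ (σ 1) := hmul _ _
    rw [mul_one, hinv, mul_one] at h1
    exact h1.symm
  have hσc (c : F) : σ (algebraMap F B c) = algebraMap F B c := by
    rw [Algebra.algebraMap_eq_smul_one, map_smul, hσ1]
  by_cases hb : ∃ c, algebraMap F B c = b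
  · obtain ⟨c, rfl⟩ := hb
    rw [hσc]
  have h1 := congrArg σ (q.mul_self_eq b)
  rw [hmul, map_sub, hmul, hσc, hσc, q.mul_self_eq (σ b), ← Algebra.commutes] at h1
  by_contra hne
  have h3 : algebraMap F B (reducedTrace F (σ b) - reducedTrace F b) * σ b =
      algebraMap F B (reducedNorm F (σ b) - reducedNorm F b) := by
    rw [map_sub, map_sub, sub_mul, sub_eq_sub_iff_sub_eq_sub, h1]
  have hd : algebraMap F B (reducedTrace F (σ b) - reducedTrace F b) ≠ 0 :=
    (map_ne_zero _).2 (sub_ne_zero.2 hne)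
  refine hb ⟨(reducedTrace F (σ b) - reducedTrace F b)⁻¹ *
    (reducedNorm F (σ b) - reducedNorm F b), ?_⟩
  rw [← hσc, map_mul, ← h3, map_inv₀, inv_mul_cancel_left₀ hd, hinv]

/-- An orthogonal involution of a quaternion algebra is the canonical involution followed by an
inner automorphism. -/
theorem exists_represents (hB : Module.finrank F B = 4) (hσ : IsOrthogonalInvolution σ) :
    ∃ γ : B, Represents σ γ := by
  have : FiniteDimensional F B := FiniteDimensional.of_finrank_pos (by omega)
  have hT := q.reducedTrace_map hσ.map_mul hσ.involutive
  -- The symmetric elements have codimension one, so `σ - 1` has image a line. A generator of this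
  -- line serves as `γ`.
  have hrank : Module.finrank F (LinearMap.range (σ - LinearMap.id)) = 1 := by
    have := LinearMap.finrank_range_add_finrank_ker (σ - LinearMap.id)
    rw [hσ.orthogonal, hB] at this
    omega
  obtain ⟨⟨γ, hγ⟩, hγ0, hγs⟩ := finrank_eq_one_iff'.1 hrank
  have hγ0 : γ ≠ 0 := fun h => hγ0 (Subtype.ext h)
  have hf (b : B) : ∃ c : F, σ b - b = c • γ := by
    obtain ⟨c, hc⟩ := hγs ⟨σ b - b, b, rfl⟩
    exact ⟨c, (congrArg Subtype.val hc).symm⟩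
  have hσγ : σ γ = - γ := by
    obtain ⟨a, rfl⟩ := hγ
    simp [hσ.involutive]
  have hTγ : reducedTrace F γ = 0 := by
    have := hT γ
    rw [hσγ, reducedTrace_neg] at this
    have h : 2 * reducedTrace F γ = 0 := by linear_combination -this
    simpa [q.two_ne_zero] using h
  have hcγ : conj F γ = - γ := by simp [conj, hTγ]
  refine ⟨γ, hγ0, by simp [hcγ], fun b => ?_⟩
  rw [eq_mul_inv_iff_mul_eq₀ hγ0]
  obtain ⟨c, hc⟩ := hf b
  have hσb : σ b = b + c • γ := by rw [← hc]; abel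
  have hγγ : γ * γ = algebraMap F B (-reducedNorm F γ) := by
    rw [q.mul_self_eq, hTγ]; simp
  -- Invariance of the trace under `σ`, applied to `bγ`, determines the coefficient `c` in `σ b = b
  -- + cγ`.
  have hTb : reducedTrace F (b * γ) = c * reducedNorm F γ := by
    have h1 := hT (b * γ)
    rw [hσ.map_mul, hσγ, hσb, neg_mul, mul_add, reducedTrace_neg, reducedTrace_add, mul_smul_comm,
      reducedTrace_smul, hγγ, q.reducedTrace_algebraMap, reducedTrace_mul_comm γ b] at h1
    have h2 : 2 * (reducedTrace F (b * γ) - c * reducedNorm F γ) = 0 := by linear_combination -h1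
    exact sub_eq_zero.1 ((mul_eq_zero.1 h2).resolve_left q.two_ne_zero)
  have h := q.mul_add_mul_comm b γ
  rw [hTγ, map_zero, zero_mul, add_zero, mul_zero, sub_zero, hTb] at h
  rw [hσb, add_mul, smul_mul_assoc, hγγ, conj, mul_sub, ← Algebra.commutes, Algebra.smul_def,
    ← map_mul, eq_sub_iff_add_eq, add_right_comm, h, add_assoc, ← map_add]
  simp

end IsQuaternion

end QuaternionAlgebra

/-! ### Integrality of reduced traces and norms. -/

section Integrality

open Polynomial

variable {F : Type u} [Field F] {B : Type v} [DivisionRing B] [Algebra F B]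
  {R : Type*} [CommRing R] [IsIntegrallyClosed R] [Algebra R F] [IsFractionRing R F]
  [Algebra R B] [IsScalarTower R F B]

/-- For noncentral `b` the reduced characteristic polynomial is the minimal polynomial over `F`. It
divides a monic polynomial over `R`, so its coefficients lie in the integrally closed ring `R`. -/
theorem IsQuaternion.exists_reducedTrace_reducedNorm_of_isIntegral (q : IsQuaternion F B) {b : B}
    (hb : IsIntegral R b) : (∃ t : R, algebraMap R F t = reducedTrace F b) ∧
      ∃ n : R, algebraMap R F n = reducedNorm F b := by
  by_cases hbF : ∃ c, algebraMap F B c = b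
  · obtain ⟨c, rfl⟩ := hbF
    rw [isIntegral_algebraMap_iff (algebraMap F B).injective] at hb
    obtain ⟨r, rfl⟩ := IsIntegrallyClosed.isIntegral_iff.1 hb
    rw [q.reducedTrace_algebraMap, q.reducedNorm_algebraMap]
    exact ⟨⟨2 * r, by rw [map_mul, map_ofNat]⟩, ⟨r * r, by simp⟩⟩
  let g : F[X] := X ^ 2 - C (reducedTrace F b) * X + C (reducedNorm F b)
  have hgdeg : g.natDegree = 2 := by simp only [g]; compute_degree!
  have hg : g.Monic := by simp only [g]; monicity!
  have hgb : aeval b g = 0 := by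
    simp only [g, map_add, map_sub, map_mul, aeval_X, aeval_C, pow_two]
    rw [q.mul_self_eq b]; abel
  have hbF' : IsIntegral F b := hb.tower_top
  have hmin : minpoly F b = g := by
    refine (eq_of_monic_of_dvd_of_natDegree_le (minpoly.monic hbF') hg
      (minpoly.dvd F b hgb) ?_).symm
    rw [hgdeg, minpoly.two_le_natDegree_iff hbF']
    rintro ⟨c, hc⟩
    exact hbF ⟨c, hc⟩
  obtain ⟨f, hf, hfb⟩ := hb
  have hdvd : g ∣ f.map (algebraMap R F) := by
    rw [← hmin]
    refine minpoly.dvd F b ?_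
    rw [aeval_map_algebraMap]
    exact hfb
  obtain ⟨g', hg'⟩ := IsIntegrallyClosed.eq_map_mul_C_of_dvd F hf hdvd
  rw [hg.leadingCoeff, C_1, mul_one] at hg'
  have hcoeff (i : ℕ) : algebraMap R F (g'.coeff i) = g.coeff i := by rw [← hg', coeff_map]
  refine ⟨⟨-g'.coeff 1, ?_⟩, ⟨g'.coeff 0, ?_⟩⟩
  · rw [map_neg, hcoeff]
    simp [g, coeff_C]
  · rw [hcoeff]
    simp [g]

end Integrality

/-! ### Orders and uniformizers. -/

section Order

variable {F : Type u} [Field F] {B : Type v} [DivisionRing B] [Algebra F B]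
  {R : Type*} [CommRing R] [Algebra R B] {O : Subalgebra R B} {P : B}

theorem isIntegral_of_mem_order (hO : IsOrder F O) {b : B} (hb : b ∈ O) : IsIntegral R b := by
  have := hO.1
  have h : IsIntegral R (⟨b, hb⟩ : O) := Algebra.IsIntegral.isIntegral _
  exact h.map O.val

theorem isUnit_mk_iff {b : B} (hb : b ∈ O) : IsUnit (⟨b, hb⟩ : O) ↔ b ≠ 0 ∧ b⁻¹ ∈ O := by
  constructor
  · rintro ⟨⟨x, y, hxy, hyx⟩, rfl : x = _⟩
    have h1 : b * y = 1 := congrArg Subtype.val hxy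
    have hb0 : b ≠ 0 := left_ne_zero_of_mul_eq_one h1
    refine ⟨hb0, ?_⟩
    rw [inv_eq_of_mul_eq_one_right h1]
    exact y.2
  · rintro ⟨hb0, hi⟩
    exact ⟨⟨⟨b, hb⟩, ⟨b⁻¹, hi⟩, Subtype.ext (mul_inv_cancel₀ hb0),
      Subtype.ext (inv_mul_cancel₀ hb0)⟩, rfl⟩

theorem IsUniformizer.eq_mul_iff (hP : IsUniformizer O P) {b : B} (hb : b ∈ O) :
    (b = 0 ∨ b⁻¹ ∉ O) ↔ ∃ c ∈ O, b = P * c := by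
  obtain ⟨hPO, h⟩ := hP
  have := h ⟨b, hb⟩
  rw [isUnit_mk_iff, not_and_or, not_not] at this
  rw [this]
  simp [Subtype.ext_iff]

variable [Algebra R F] [IsScalarTower R F B]

theorem algebraMap_mem_order (r : R) : algebraMap F B (algebraMap R F r) ∈ O := by
  rw [← IsScalarTower.algebraMap_apply]; exact O.algebraMap_mem r

variable [IsIntegrallyClosed R] [IsFractionRing R F]

theorem exists_of_algebraMap_mem_order (hO : IsOrder F O) {c : F} (hc : algebraMap F B c ∈ O) :
    ∃ r : R, algebraMap R F r = c := by
  have := isIntegral_of_mem_order hO hc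
  rw [isIntegral_algebraMap_iff (algebraMap F B).injective] at this
  exact IsIntegrallyClosed.isIntegral_iff.1 this

/-- The center of an order with a uniformizer is local. -/
theorem isLocalRing_of_isUniformizer [IsDomain R] (hO : IsOrder F O) (hP : IsUniformizer O P) :
    IsLocalRing R := by
  -- The nonunits of `R` are its elements in `P O`, a condition closed under addition.
  have key (a : R) : a ∈ nonunits R ↔ ∃ c ∈ O, algebraMap F B (algebraMap R F a) = P * c := by
    rw [← hP.eq_mul_iff (algebraMap_mem_order a), mem_nonunits_iff, ← not_iff_not, not_not,
      not_or, not_not]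
    constructor
    · rintro ⟨u, rfl⟩
      refine ⟨?_, ?_⟩
      · rw [map_eq_zero, map_eq_zero_iff _ (IsFractionRing.injective R F)]
        exact u.ne_zero
      · have : (algebraMap F B (algebraMap R F u))⁻¹ = algebraMap F B (algebraMap R F ↑u⁻¹) := by
          apply inv_eq_of_mul_eq_one_right
          rw [← map_mul, ← map_mul, Units.mul_inv, map_one, map_one]
        rw [this]
        exact algebraMap_mem_order _
    · rintro ⟨h0, hi⟩
      rw [← map_inv₀] at hi
      obtain ⟨s, hs⟩ := exists_of_algebraMap_mem_order hO hi
      rw [map_eq_zero] at h0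
      refine IsUnit.of_mul_eq_one s ?_
      apply IsFractionRing.injective R F
      rw [map_mul, hs, mul_inv_cancel₀ h0, map_one]
  refine IsLocalRing.of_nonunits_add fun a b ha hb => ?_
  rw [key] at *
  obtain ⟨c, hc, hac⟩ := ha
  obtain ⟨d, hd, hbd⟩ := hb
  exact ⟨c + d, O.add_mem hc hd, by rw [map_add, map_add, hac, hbd, mul_add]⟩

end Order

/-! ### The filtration by powers of the uniformizer. -/

section Powers

variable {B : Type v} [DivisionRing B] {R : Type*} [CommRing R] [Algebra R B]

/-- `b` lies in `P ^ k O`. -/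
def InPow (O : Subalgebra R B) (P : B) (k : ℤ) (b : B) : Prop := P ^ (-k) * b ∈ O

variable {O : Subalgebra R B} {P : B} {k : ℤ} {a b : B}

theorem InPow.add (ha : InPow O P k a) (hb : InPow O P k b) : InPow O P k (a + b) := by
  rw [InPow, mul_add]; exact O.add_mem ha hb

theorem InPow.neg (ha : InPow O P k a) : InPow O P k (-a) := by
  rw [InPow, mul_neg]; exact O.neg_mem ha

theorem inPow_zero_right : InPow O P k 0 := by
  rw [InPow, mul_zero]; exact O.zero_mem

theorem inPow_zero_iff : InPow O P 0 b ↔ b ∈ O := by simp [InPow]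

end Powers

/-- The data `O`, `P`, `π` behave as the maximal order, a uniformizer and its reduced norm in a
quaternion division algebra over a discretely valued field. -/
structure IsValuationOrder (F : Type u) [Field F] {B : Type v} [DivisionRing B] [Algebra F B]
    {R : Type*} [CommRing R] [Algebra R F] [Algebra R B] (O : Subalgebra R B) (P : B) (π : R) :
    Prop where
  uniformizer_ne_zero : P ≠ 0
  reducedNorm_uniformizer : reducedNorm F P = algebraMap R F π
  inPow_iff : ∀ k b, InPow O P k b ↔
    ∃ r : R, algebraMap R F r = algebraMap R F π ^ (-k) * reducedNorm F b
  exists_inPow : ∀ b : B, b ≠ 0 → ∃ k, InPow O P k b ∧ InPow O P (-k) b⁻¹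
  conj_mem : ∀ b ∈ O, conj F b ∈ O
  algebraMap_mem_iff : ∀ c : F, algebraMap F B c ∈ O ↔ ∃ r : R, algebraMap R F r = c

/-! ### The valuation of `B` read off from the reduced norm. -/

section Valuation

variable {F : Type u} [Field F] {B : Type v} [DivisionRing B] [Algebra F B]
  {R : Type*} [CommRing R] [IsDomain R] [Algebra R F]
  [IsFractionRing R F] [Algebra R B] [IsScalarTower R F B] {O : Subalgebra R B} {P : B}

theorem exists_smul_mem_order (hO : IsOrder F O) (b : B) :
    ∃ r : R, r ≠ 0 ∧ algebraMap F B (algebraMap R F r) * b ∈ O := by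
  have hb : b ∈ Submodule.span F (O : Set B) := hO.2 ▸ Submodule.mem_top
  induction hb using Submodule.span_induction with
  | mem x hx => exact ⟨1, one_ne_zero, by simpa using hx⟩
  | zero => exact ⟨1, one_ne_zero, by simp⟩
  | add x y _ _ hx hy =>
    obtain ⟨r, hr, hrx⟩ := hx
    obtain ⟨s, hs, hsy⟩ := hy
    refine ⟨r * s, mul_ne_zero hr hs, ?_⟩
    have e : algebraMap F B (algebraMap R F (r * s)) * (x + y) =
        algebraMap F B (algebraMap R F s) * (algebraMap F B (algebraMap R F r) * x) +
        algebraMap F B (algebraMap R F r) * (algebraMap F B (algebraMap R F s) * y) := by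
      rw [← mul_assoc, ← mul_assoc, ← map_mul, ← map_mul, ← map_mul, ← map_mul, mul_comm s r,
        mul_add]
    rw [e]
    exact O.add_mem (O.mul_mem (algebraMap_mem_order s) hrx)
      (O.mul_mem (algebraMap_mem_order r) hsy)
  | smul c x _ hx =>
    obtain ⟨r, hr, hrx⟩ := hx
    obtain ⟨m, d, hd, rfl⟩ := IsFractionRing.div_surjective R c
    have hd0 : d ≠ 0 := nonZeroDivisors.ne_zero hd
    have hd1 : algebraMap R F d ≠ 0 := by
      rwa [Ne, map_eq_zero_iff _ (IsFractionRing.injective R F)]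
    refine ⟨r * d, mul_ne_zero hr hd0, ?_⟩
    have e : algebraMap F B (algebraMap R F (r * d)) * ((algebraMap R F m / algebraMap R F d) • x)
        = algebraMap F B (algebraMap R F m) * (algebraMap F B (algebraMap R F r) * x) := by
      rw [Algebra.smul_def, ← mul_assoc, ← mul_assoc, ← map_mul, ← map_mul, map_mul (algebraMap R F)]
      congr 2
      field_simp
    rw [e]
    exact O.mul_mem (algebraMap_mem_order m) hrx

/-- Pulling a factor `P` out of a nonzero nonunit divides its norm by `π`, so the process stops and
every nonzero element is a power of `P` times a unit of `O`. Consequently `O` consists of the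
elements of integral norm, and later valuation arguments reduce to norms. -/
theorem isValuationOrder [IsDiscreteValuationRing R] (q : IsQuaternion F B) (hO : IsOrder F O) (hP : IsUniformizer O P)
    {π : R} (hπ : Irreducible π)
    (hPπ : P * conj F P = algebraMap F B (algebraMap R F π)) :
    IsValuationOrder F O P π := by
  have hinj := IsFractionRing.injective R F
  have hPO : P ∈ O := hP.1
  have hπ0 : algebraMap R F π ≠ 0 := by
    rw [Ne, map_eq_zero_iff _ hinj]; exact hπ.ne_zero
  have hP0 : P ≠ 0 := by
    rintro rfl
    rw [zero_mul] at hPπ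
    exact hπ0 ((map_eq_zero _).1 hPπ.symm)
  have hNP : reducedNorm F P = algebraMap R F π := by
    apply (algebraMap F B).injective
    rw [← q.mul_conj, hPπ]
  have hT (b : B) (hb : b ∈ O) :=
    (q.exists_reducedTrace_reducedNorm_of_isIntegral (isIntegral_of_mem_order hO hb)).1
  have hN (b : B) (hb : b ∈ O) :=
    (q.exists_reducedTrace_reducedNorm_of_isIntegral (isIntegral_of_mem_order hO hb)).2
  have hconj (b : B) (hb : b ∈ O) : conj F b ∈ O := by
    obtain ⟨t, ht⟩ := hT b hb
    rw [conj, ← ht]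
    exact O.sub_mem (algebraMap_mem_order t) hb
  -- factorization of integral elements
  have hfac (n : ℕ) : ∀ b ∈ O, b ≠ 0 → ∀ r : R, algebraMap R F r = reducedNorm F b → ¬ π ^ n ∣ r →
      ∃ (k : ℕ) (u : B), u ∈ O ∧ u⁻¹ ∈ O ∧ u ≠ 0 ∧ b = P ^ k * u := by
    induction n with
    | zero => intro b _ _ r _ h; simp at h
    | succ n ih =>
      intro b hb hb0 r hr hn
      by_cases hbi : b⁻¹ ∈ O
      · exact ⟨0, b, hb, hbi, hb0, by simp⟩
      obtain ⟨c, hc, rfl⟩ := (hP.eq_mul_iff hb).1 (Or.inr hbi)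
      obtain ⟨s, hs⟩ := hN c hc
      have hrs : r = π * s := by
        apply hinj
        rw [hr, q.reducedNorm_mul, hNP, map_mul, hs]
      obtain ⟨k, u, hu, hui, hu0, rfl⟩ := ih c hc (right_ne_zero_of_mul hb0) s hs (fun h => hn (by
        rw [hrs, pow_succ']; exact mul_dvd_mul_left π h))
      exact ⟨k + 1, u, hu, hui, hu0, by rw [pow_succ', mul_assoc]⟩
  have hfac' (b : B) (hb : b ∈ O) (hb0 : b ≠ 0) :
      ∃ (k : ℕ) (u : B), u ∈ O ∧ u⁻¹ ∈ O ∧ u ≠ 0 ∧ b = P ^ k * u := by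
    obtain ⟨r, hr⟩ := hN b hb
    have hr0 : r ≠ 0 := by
      rintro rfl
      rw [map_zero] at hr
      exact q.reducedNorm_ne_zero hb0 hr.symm
    obtain ⟨n, hn⟩ := FiniteMultiplicity.of_not_isUnit hπ.not_isUnit hr0
    exact hfac (n + 1) b hb hb0 r hr hn
  have hfacB (b : B) (hb0 : b ≠ 0) :
      ∃ (k : ℤ) (u : B), u ∈ O ∧ u⁻¹ ∈ O ∧ u ≠ 0 ∧ b = P ^ k * u := by
    obtain ⟨r, hr, hrb⟩ := exists_smul_mem_order hO b
    set z := algebraMap F B (algebraMap R F r) with hz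
    have hz0 : z ≠ 0 := by
      rw [hz, Ne, map_eq_zero, map_eq_zero_iff _ hinj]; exact hr
    have hzc (x : B) : z * x = x * z := Algebra.commutes _ _
    obtain ⟨j, v, hv, hvi, hv0, hzv⟩ := hfac' z (algebraMap_mem_order r) hz0
    obtain ⟨k, u, hu, hui, hu0, hzb⟩ := hfac' (z * b) hrb (mul_ne_zero hz0 hb0)
    -- The denominator `z = P^j v` is central, so `P` commutes with `v`. This lets the powers of `P`
    -- in `z⁻¹ (z b)` be moved to the left.
    have hPj : P ^ j ≠ 0 := pow_ne_zero _ hP0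
    have hPv : Commute P v := by
      have h1 : P ^ j * (P * v) = P ^ j * (v * P) := by
        rw [← mul_assoc, ← mul_assoc, ← hzv, hzc, ← pow_succ, pow_succ', mul_assoc, ← hzv]
      exact mul_left_cancel₀ hPj h1
    refine ⟨(k : ℤ) - j, v⁻¹ * u, O.mul_mem hvi hu, ?_, mul_ne_zero (inv_ne_zero hv0) hu0, ?_⟩
    · rw [mul_inv_rev, inv_inv]; exact O.mul_mem hui hv
    · apply mul_left_cancel₀ hz0
      rw [hzb, hzv, sub_eq_neg_add, zpow_add₀ hP0]
      have h2 : v * (P ^ (-(j : ℤ)) * P ^ (k : ℤ)) = (P ^ (-(j : ℤ)) * P ^ (k : ℤ)) * v := by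
        rw [← zpow_add₀ hP0]
        exact (hPv.symm.zpow_right₀ _).eq
      rw [← mul_assoc (P ^ j * v), mul_assoc (P ^ j) v, h2, mul_assoc, mul_assoc _ v,
        mul_inv_cancel_left₀ hv0, zpow_neg, zpow_natCast, zpow_natCast, mul_assoc,
        mul_inv_cancel_left₀ hPj]
  have hNz (k : ℤ) : reducedNorm F (P ^ k) = algebraMap R F π ^ k := by
    rw [q.reducedNorm_zpow, hNP]
  have hmem (b : B) : b ∈ O ↔ ∃ r : R, algebraMap R F r = reducedNorm F b := by
    refine ⟨hN b, ?_⟩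
    rintro ⟨r, hr⟩
    rcases eq_or_ne b 0 with rfl | hb0
    · exact O.zero_mem
    obtain ⟨k, u, hu, hui, hu0, rfl⟩ := hfacB b hb0
    have hk : 0 ≤ k := by
      by_contra! hk
      obtain ⟨n, rfl⟩ : ∃ n : ℕ, k = -((n : ℤ) + 1) := ⟨(-k - 1).toNat, by omega⟩
      obtain ⟨s, hs⟩ := hN _ hui
      rw [q.reducedNorm_inv] at hs
      refine hπ.not_isUnit (IsUnit.of_mul_eq_one (π ^ n * (r * s)) ?_)
      apply hinj
      have := q.reducedNorm_ne_zero hu0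
      rw [map_mul, map_mul, map_mul, hr, hs, q.reducedNorm_mul, hNz, map_pow, map_one,
        zpow_neg, ← Nat.cast_succ, zpow_natCast]
      field_simp
      exact (pow_succ' _ _).symm
    obtain ⟨n, rfl⟩ := Int.eq_ofNat_of_zero_le hk
    rw [zpow_natCast]
    exact O.mul_mem (O.pow_mem hPO n) hu
  exact {
    uniformizer_ne_zero := hP0
    reducedNorm_uniformizer := hNP
    inPow_iff := fun k b => by
      rw [InPow, hmem, q.reducedNorm_mul, hNz]
    exists_inPow := fun b hb => by
      obtain ⟨k, u, hu, hui, hu0, rfl⟩ := hfacB b hb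
      refine ⟨k, ?_, ?_⟩
      · rw [InPow, ← mul_assoc, ← zpow_add₀ hP0, neg_add_cancel, zpow_zero, one_mul]
        exact hu
      · rw [InPow, hmem, q.reducedNorm_mul, q.reducedNorm_inv, q.reducedNorm_mul, hNz, hNz, neg_neg]
        obtain ⟨s, hs⟩ := hN _ hui
        refine ⟨s, ?_⟩
        have := zpow_ne_zero k hπ0
        rw [hs, q.reducedNorm_inv, mul_inv, mul_inv_cancel_left₀ this]
    conj_mem := hconj
    algebraMap_mem_iff := fun c => by
      refine ⟨exists_of_algebraMap_mem_order hO, ?_⟩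
      rintro ⟨r, rfl⟩
      exact algebraMap_mem_order r }

end Valuation

namespace IsValuationOrder

variable {F : Type u} [Field F] {B : Type v} [DivisionRing B] [Algebra F B]
  {R : Type*} [CommRing R] [Algebra R F] [Algebra R B] {O : Subalgebra R B} {P : B} {π : R}
  (h : IsValuationOrder F O P π) (q : IsQuaternion F B) {k l : ℤ} {a b : B}
include h q

theorem algebraMap_ne_zero : algebraMap R F π ≠ 0 := by
  rw [← h.reducedNorm_uniformizer]
  exact q.reducedNorm_ne_zero h.uniformizer_ne_zero

/-- Multiplicativity of the norm replaces the argument that `P` normalizes `O`. -/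
theorem inPow_mul (ha : InPow O P k a) (hb : InPow O P l b) : InPow O P (k + l) (a * b) := by
  rw [h.inPow_iff] at *
  obtain ⟨r, hr⟩ := ha
  obtain ⟨s, hs⟩ := hb
  refine ⟨r * s, ?_⟩
  rw [map_mul, hr, hs, q.reducedNorm_mul, neg_add, zpow_add₀ (h.algebraMap_ne_zero q)]
  ring

theorem inPow_conj (ha : InPow O P k a) : InPow O P k (conj F a) := by
  rw [h.inPow_iff] at *
  rwa [q.reducedNorm_conj]

theorem inPow_mono (hkl : k ≤ l) (ha : InPow O P l a) : InPow O P k a := by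
  rw [h.inPow_iff] at *
  obtain ⟨r, hr⟩ := ha
  obtain ⟨n, rfl⟩ := Int.le.dest hkl
  refine ⟨π ^ n * r, ?_⟩
  rw [map_mul, map_pow, hr, ← mul_assoc, ← zpow_natCast, ← zpow_add₀ (h.algebraMap_ne_zero q)]
  congr 2; omega

omit q in
theorem inPow_zpow (k : ℤ) : InPow O P k (P ^ k) := by
  rw [InPow, ← zpow_add₀ h.uniformizer_ne_zero, neg_add_cancel, zpow_zero]
  exact O.one_mem

theorem inPow_algebraMap_zpow (k : ℤ) :
    InPow O P (2 * k) (algebraMap F B (algebraMap R F π ^ k)) := by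
  rw [h.inPow_iff, q.reducedNorm_algebraMap]
  refine ⟨1, ?_⟩
  rw [← zpow_add₀ (h.algebraMap_ne_zero q), ← zpow_add₀ (h.algebraMap_ne_zero q), map_one]
  rw [show -(2 * k) + (k + k) = 0 by ring, zpow_zero]

theorem inPow_mul_left_iff {x : B} (hx : x ≠ 0) (h1 : InPow O P k x) (h2 : InPow O P (-k) x⁻¹) :
    InPow O P (k + l) (x * b) ↔ InPow O P l b := by
  refine ⟨fun hb => ?_, fun hb => h.inPow_mul q h1 hb⟩
  have := h.inPow_mul q h2 hb
  rwa [inv_mul_cancel_left₀ hx, neg_add_cancel_left] at this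

end IsValuationOrder

/-- The norm form of a quadratic polynomial without roots over a finite field represents
everything. -/
theorem exists_sq_add_mul_add_mul_sq_eq {κ : Type*} [Field κ] [Finite κ] {t n : κ}
    (h : ∀ a : κ, a ^ 2 - t * a + n ≠ 0) (u : κ) :
    ∃ x y : κ, x ^ 2 + t * (x * y) + n * y ^ 2 = u := by
  have := Fintype.ofFinite κ
  by_cases h2 : ringChar κ = 2
  · obtain ⟨a, ha⟩ := FiniteField.isSquare_of_char_two h2 u
    exact ⟨a, 0, by rw [ha]; ring⟩
  have h20 : (2 : κ) ≠ 0 := Ring.two_ne_zero h2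
  have hodd : Fintype.card κ % 2 = 1 := by
    have := mt FiniteField.even_card_iff_char_two.2 h2
    omega
  have hc : n - t ^ 2 / 4 ≠ 0 := by
    have := h (t / 2)
    intro h0
    apply this
    have h4 : (4 : κ) = 2 * 2 := by norm_num
    rw [← h0, h4]
    field_simp
    ring
  open Polynomial in
  -- In odd characteristic the form becomes `a² + (n - t²/4) b²` after completing the square. It is
  -- nondegenerate because `t/2` is not a root, so it represents every `u`.
  obtain ⟨a, b, hab⟩ := FiniteField.exists_root_sum_quadratic (R := κ)
    (f := X ^ 2) (g := C (n - t ^ 2 / 4) * X ^ 2 + C 0 * X + C (-u))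
    (by simp) (degree_quadratic hc) hodd
  simp only [Polynomial.eval_pow, Polynomial.eval_X, Polynomial.eval_add, Polynomial.eval_mul,
    Polynomial.eval_C, zero_mul, add_zero] at hab
  refine ⟨a - t * b / 2, b, ?_⟩
  have h4 : (4 : κ) = 2 * 2 := by norm_num
  rw [h4] at hab
  have h3 : a ^ 2 + (n - t ^ 2 / (2 * 2)) * b ^ 2 = u := by linear_combination hab
  rw [← h3]
  field_simp
  ring

/-- A finite field of characteristic two is perfect, so `a² + n` always has a root. -/
theorem trace_ne_zero_of_forall_ne_zero {κ : Type*} [Field κ] [Finite κ] {t n : κ}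
    (h : ∀ a : κ, a ^ 2 - t * a + n ≠ 0) (h2 : (2 : κ) = 0) : t ≠ 0 := by
  rintro rfl
  have h2' : ringChar κ = 2 := by
    by_contra h'
    exact Ring.two_ne_zero h' h2
  obtain ⟨a, ha⟩ := FiniteField.isSquare_of_char_two h2' n
  apply h a
  rw [ha]
  linear_combination a ^ 2 * h2

/-- The data `O`, `P`, `π` behave as the maximal order, a uniformizer and its reduced norm in a
quaternion division algebra over a local field. -/
structure IsLocalOrder (F : Type u) [Field F] {B : Type v} [DivisionRing B] [Algebra F B]
    {R : Type*} [CommRing R] [Algebra R F] [Algebra R B] (O : Subalgebra R B) (P : B) (π : R) :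
    Prop extends IsValuationOrder F O P π where
  isQuaternion : IsQuaternion F B
  exists_reducedTrace_eq_one : ∃ w ∈ O, reducedTrace F w = 1
  exists_reducedNorm_eq : ∀ u : R, IsUnit u → ∃ b ∈ O, reducedNorm F b = algebraMap R F u
  exists_add_mul_sq_eq : ∀ s c : R, ∃ t : R, t + π * c * t ^ 2 = s

/-! ### Trace one elements and unit norms from the residue extension. -/

section Residue

variable {F : Type u} [Field F] {B : Type v} [DivisionRing B] [Algebra F B]
  {R : Type*} [CommRing R] [IsDomain R] [IsDiscreteValuationRing R] [Algebra R F]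
  [IsFractionRing R F] [Algebra R B] [IsScalarTower R F B] {O : Subalgebra R B} {P : B} {π : R}

omit [IsDomain R] [IsDiscreteValuationRing R] [IsScalarTower R F B] in
theorem IsValuationOrder.inPow_iff_dvd (h : IsValuationOrder F O P π) (q : IsQuaternion F B)
    {b : B} {r : R} (hr : algebraMap R F r = reducedNorm F b) : InPow O P 1 b ↔ π ∣ r := by
  have h0 := h.algebraMap_ne_zero q
  rw [h.inPow_iff, ← hr]
  refine exists_congr fun c => ?_
  rw [zpow_neg_one, eq_inv_mul_iff_mul_eq₀ h0, ← map_mul, eq_comm,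
    (IsFractionRing.injective R F).eq_iff]

omit [IsFractionRing R F] in
/-- The residue division ring is larger than the residue field of the center. -/
theorem IsValuationOrder.exists_not_inPow_one (h : IsValuationOrder F O P π)
    (q : IsQuaternion F B) (hπ : Irreducible π) (hO : IsOrder F O)
    (hB : Module.finrank F B = 4) :
    ∃ b ∈ O, ∀ a : R, ¬ InPow O P 1 (b - algebraMap F B (algebraMap R F a)) := by
  by_contra! H
  have hP0 := h.uniformizer_ne_zero
  have key (b : B) (hb : b ∈ O) : ∃ a : R, ∃ c ∈ O,
      b = algebraMap F B (algebraMap R F a) + P * c := by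
    obtain ⟨a, ha⟩ := H b hb
    refine ⟨a, _, ha, ?_⟩
    rw [zpow_neg_one, mul_inv_cancel_left₀ hP0]
    abel
  have hsmul (r : R) (b : B) : r • b = algebraMap F B (algebraMap R F r) * b := by
    rw [Algebra.smul_def, IsScalarTower.algebraMap_apply R F B]
  -- If `O = R + P O`, then iterating once gives `O = R + R P + π O`, as `P²O = π O`. Nakayama
  -- leaves two generators, too few for dimension 4.
  have hle : Subalgebra.toSubmodule O ≤ Submodule.span R {1, P} := by
    have : Module.Finite R O := hO.1
    refine Submodule.le_of_le_smul_of_le_jacobson_bot (I := Ideal.span {π})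
      (Module.Finite.iff_fg.1 this) ?_ ?_
    · rw [← hπ.maximalIdeal_eq]
      exact IsLocalRing.maximalIdeal_le_jacobson _
    · intro b hb
      obtain ⟨a, c, hc, rfl⟩ := key b hb
      obtain ⟨a', c', hc', rfl⟩ := key c hc
      have h1 : InPow O P 2 (P * P * c') := by
        have h3 := h.inPow_mul q (h.inPow_mul q (h.inPow_zpow 1) (h.inPow_zpow 1))
          (inPow_zero_iff.2 hc')
        rwa [zpow_one] at h3
      have h2 := h.inPow_mul q (h.inPow_algebraMap_zpow q (-1)) h1
      have h3 : _ ∈ O := inPow_zero_iff.1 h2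
      have e : algebraMap F B (algebraMap R F a) +
          P * (algebraMap F B (algebraMap R F a') + P * c') = (a • (1 : B) + a' • P) +
            π • (algebraMap F B (algebraMap R F π ^ (-1 : ℤ)) * (P * P * c')) := by
        rw [hsmul, hsmul, hsmul, mul_one, ← mul_assoc (algebraMap F B (algebraMap R F π)), ← map_mul,
          zpow_neg_one, mul_inv_cancel₀ (h.algebraMap_ne_zero q), map_one, one_mul, mul_add,
          Algebra.commutes _ P, mul_assoc, add_assoc]
      rw [e]
      refine Submodule.add_mem_sup (Submodule.add_mem _ ?_ ?_) ?_
      · exact Submodule.smul_mem _ _ (Submodule.subset_span (by simp))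
      · exact Submodule.smul_mem _ _ (Submodule.subset_span (by simp))
      · exact Submodule.smul_mem_smul (Ideal.mem_span_singleton_self π) h3
  have htop : Submodule.span F ({1, P} : Set B) = ⊤ := by
    rw [eq_top_iff, ← hO.2, Submodule.span_le]
    intro b hb
    exact Submodule.span_le_restrictScalars R F ({1, P} : Set B) (hle hb)
  classical
  have := finrank_span_finset_le_card (R := F) ({1, P} : Finset B)
  rw [Set.finrank, Finset.coe_insert, Finset.coe_singleton, htop, finrank_top, hB] at this
  have := Finset.card_le_two (a := (1 : B)) (b := P)
  omega

/-- An element `b` whose residue lies outside the residue field of the center generates a quadratic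
residue extension. Its norm form represents all residues, and an element of trace one allows the
remaining error, a factor congruent to 1, to be realized as a norm. -/
theorem isLocalOrder [Finite (IsLocalRing.ResidueField R)]
    (hH : ∀ s c : R, ∃ t : R, t + π * c * t ^ 2 = s) (h : IsValuationOrder F O P π)
    (q : IsQuaternion F B) (hπ : Irreducible π) (hO : IsOrder F O)
    (hB : Module.finrank F B = 4) : IsLocalOrder F O P π := by
  have hinj := IsFractionRing.injective R F
  have hres (r : R) : IsLocalRing.residue R r = 0 ↔ π ∣ r := by
    rw [IsLocalRing.residue_eq_zero_iff, hπ.maximalIdeal_eq, Ideal.mem_span_singleton]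
  have hunit (r : R) (hr : IsLocalRing.residue R r ≠ 0) : IsUnit r := by
    rwa [Ne, IsLocalRing.residue_eq_zero_iff, IsLocalRing.mem_maximalIdeal, mem_nonunits_iff,
      not_not] at hr
  obtain ⟨b, hb, hba⟩ := h.exists_not_inPow_one q hπ hO hB
  obtain ⟨⟨t, ht⟩, n, hn⟩ :=
    q.exists_reducedTrace_reducedNorm_of_isIntegral (isIntegral_of_mem_order hO hb)
  -- The value at `a` is the residue of `Nrd(b - a)`, and `b - a` is not in `P O`.
  have hpoly : ∀ a : IsLocalRing.ResidueField R,
      a ^ 2 - IsLocalRing.residue R t * a + IsLocalRing.residue R n ≠ 0 := by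
    intro a
    obtain ⟨a, rfl⟩ := IsLocalRing.residue_surjective a
    rw [← map_pow, ← map_mul, ← map_sub, ← map_add, Ne, hres, ← h.inPow_iff_dvd q
      (b := b - algebraMap F B (algebraMap R F a))]
    · exact hba a
    · rw [sub_eq_add_neg b, ← map_neg (algebraMap F B), q.reducedNorm_add_algebraMap, ← ht, ← hn]
      simp only [map_add, map_sub, map_mul, map_pow]
      ring
  obtain ⟨w, hw, hw1⟩ : ∃ w ∈ O, reducedTrace F w = 1 := by
    have aux (b : B) (hb : b ∈ O) (t : R) (ht : algebraMap R F t = reducedTrace F b)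
        (hu : IsUnit t) : ∃ w ∈ O, reducedTrace F w = 1 := by
      obtain ⟨s, hs⟩ := hu.exists_left_inv
      refine ⟨algebraMap R F s • b, ?_, ?_⟩
      · rw [Algebra.smul_def]
        exact O.mul_mem (algebraMap_mem_order s) hb
      · rw [reducedTrace_smul, ← ht, ← map_mul, hs, map_one]
    -- In residue characteristic two the trace of `b` is a unit; otherwise `Trd(1) = 2` is one.
    by_cases h2 : (2 : IsLocalRing.ResidueField R) = 0
    · exact aux b hb t ht (hunit t (trace_ne_zero_of_forall_ne_zero hpoly h2))
    · refine aux 1 O.one_mem 2 ?_ (hunit 2 (by rwa [map_ofNat]))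
      rw [map_ofNat, ← map_one (algebraMap F B), q.reducedTrace_algebraMap, mul_one]
  obtain ⟨m, hm⟩ :=
    (q.exists_reducedTrace_reducedNorm_of_isIntegral (isIntegral_of_mem_order hO hw)).2
  refine ⟨h, q, ⟨w, hw, hw1⟩, fun u hu => ?_, hH⟩
  obtain ⟨x, y, hxy⟩ := exists_sq_add_mul_add_mul_sq_eq hpoly (IsLocalRing.residue R u)
  obtain ⟨x, rfl⟩ := IsLocalRing.residue_surjective x
  obtain ⟨y, rfl⟩ := IsLocalRing.residue_surjective y
  simp only [← map_pow, ← map_mul, ← map_add] at hxy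
  set v : R := x ^ 2 + t * (x * y) + n * y ^ 2 with hv
  have hNz : reducedNorm F (algebraMap R F y • b + algebraMap F B (algebraMap R F x)) =
      algebraMap R F v := by
    rw [q.reducedNorm_add_algebraMap, q.reducedNorm_smul, reducedTrace_smul, ← ht, ← hn, hv]
    simp only [map_add, map_mul, map_pow]
    ring
  have hvu : IsUnit v := hunit v (by
    rw [hxy]
    exact (hu.map (IsLocalRing.residue R)).ne_zero)
  obtain ⟨v', hv'⟩ := hvu.exists_left_inv
  obtain ⟨e, he⟩ : π ∣ u - v := by rw [← hres, map_sub, hxy, sub_self]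
  -- With `u = v + πe` and `Nrd(1 + πs w) = 1 + πs + π²m s²`, the correction needed is `s + πm s² =
  -- v⁻¹e`.
  obtain ⟨s, hs⟩ := hH (v' * e) m
  refine ⟨(algebraMap R F y • b + algebraMap F B (algebraMap R F x)) *
    (algebraMap R F (π * s) • w + algebraMap F B 1), O.mul_mem (O.add_mem ?_ ?_)
      (O.add_mem ?_ ?_), ?_⟩
  · rw [Algebra.smul_def]
    exact O.mul_mem (algebraMap_mem_order y) hb
  · exact algebraMap_mem_order x
  · rw [Algebra.smul_def]
    exact O.mul_mem (algebraMap_mem_order _) hw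
  · rw [map_one]; exact O.one_mem
  · rw [q.reducedNorm_mul, hNz, q.reducedNorm_add_algebraMap, q.reducedNorm_smul,
      reducedTrace_smul, hw1, ← hm]
    rw [← map_one (algebraMap R F)]
    simp only [← map_pow, ← map_mul, ← map_add]
    congr 1
    linear_combination v * π * hs - he + π * e * hv'

end Residue

/-! ### Solving `t + πct² = s` by completeness. -/

section Complete

/-- For finite `M` the completion of `M` is a quotient of the tensor product of `M` with the
completion of `A`, and elements of the latter come from `A`. -/
theorem isPrecomplete_of_finite {A M : Type*} [CommRing A] [AddCommGroup M] [Module A M]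
    (I : Ideal A) [IsPrecomplete I A] [Module.Finite A M] : IsPrecomplete I M := by
  rw [← AdicCompletion.of_surjective_iff]
  intro x
  obtain ⟨y, rfl⟩ := AdicCompletion.ofTensorProduct_surjective_of_finite I M x
  induction y using TensorProduct.induction_on with
  | zero => exact ⟨0, by simp⟩
  | tmul c m =>
    obtain ⟨a, rfl⟩ := AdicCompletion.of_surjective_iff.2 (inferInstanceAs (IsPrecomplete I A)) c
    refine ⟨a • m, ?_⟩
    rw [AdicCompletion.ofTensorProduct_tmul, map_smul]
    rfl
  | add y z hy hz =>
    obtain ⟨a, ha⟩ := hy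
    obtain ⟨b, hb⟩ := hz
    exact ⟨a + b, by rw [map_add, map_add, ha, hb]⟩

/-- The iteration `t ↦ s - πct²` is contracting: the `k`-th increment is divisible by `π^k`. Its
limit is a fixed point. -/
theorem exists_add_mul_sq_eq_of_isAdicComplete {A R : Type*} [CommRing A] [IsNoetherianRing A]
    [IsLocalRing A] [IsPrecomplete (IsLocalRing.maximalIdeal A) A] [CommRing R] [Algebra A R]
    [Module.Finite A R] {π : R} {e : ℕ}
    (he : π ^ e ∈ (IsLocalRing.maximalIdeal A).map (algebraMap A R)) (s c : R) :
    ∃ t : R, t + π * c * t ^ 2 = s := by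
  set I := IsLocalRing.maximalIdeal A
  have hI (n : ℕ) (x : R) :
      x ∈ (I ^ n • ⊤ : Submodule A R) ↔ x ∈ (I.map (algebraMap A R)) ^ n := by
    rw [Ideal.smul_top_eq_map, Ideal.map_pow]; rfl
  let t : ℕ → R := fun k => Nat.rec s (fun _ x => s - π * c * x ^ 2) k
  have ht (k : ℕ) : t (k + 1) = s - π * c * t k ^ 2 := rfl
  have hdiff (k : ℕ) : π ^ k ∣ t (k + 1) - t k := by
    induction k with
    | zero => simp
    | succ k ih =>
      obtain ⟨d, hd⟩ := ih
      rw [ht (k + 1), ht k]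
      refine ⟨-(c * d * (t (k + 1) + t k)), ?_⟩
      linear_combination (-π * c * (t (k + 1) + t k)) * hd
  have hdiff' (k m : ℕ) : π ^ k ∣ t (k + m) - t k := by
    induction m with
    | zero => simp
    | succ m ih =>
      have : t (k + (m + 1)) - t k = (t (k + m + 1) - t (k + m)) + (t (k + m) - t k) := by
        rw [← add_assoc]; ring
      rw [this]
      exact dvd_add ((pow_dvd_pow π (Nat.le_add_right k m)).trans (hdiff _)) ih
  have hpow (n : ℕ) (x : R) (hx : π ^ (e * n) ∣ x) : x ∈ (I.map (algebraMap A R)) ^ n := by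
    refine Ideal.mem_of_dvd _ hx ?_
    rw [pow_mul]
    exact Ideal.pow_mem_pow he n
  have := isPrecomplete_of_finite (M := R) I
  -- Passing to every `e`-th iterate converts divisibility by `π^(en)` into membership in the `n`-th
  -- power of the ideal from `A`.
  obtain ⟨L, hL⟩ := IsPrecomplete.prec this (f := fun n => t (e * n)) (by
    intro m n hmn
    rw [SModEq.sub_mem, hI]
    refine hpow m _ ?_
    obtain ⟨j, rfl⟩ := Nat.exists_eq_add_of_le hmn
    rw [← dvd_neg, neg_sub, mul_add]
    exact hdiff' _ _)
  refine ⟨L, sub_eq_zero.1 ?_⟩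
  refine IsHausdorff.haus (I := I) inferInstance _ fun n => ?_
  rw [SModEq.zero, hI]
  have h1 := hL n
  rw [SModEq.sub_mem, hI] at h1
  have h2 := hpow n _ (hdiff (e * n))
  have e1 : L + π * c * L ^ 2 - s =
      (-(1 + π * c * (L + t (e * n)))) * (t (e * n) - L) - (t (e * n + 1) - t (e * n)) := by
    rw [ht]; ring
  rw [e1]
  exact Ideal.sub_mem _ (Ideal.mul_mem_left _ _ h1) h2

end Complete

/-! ### The maximal order over a local field. -/

section LocalField

variable {F₀ : Type u₀} [Field F₀] [ValuativeRel F₀] [TopologicalSpace F₀]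
    [IsNonarchimedeanLocalField F₀]
    {F : Type u} [Field F] [Algebra F₀ F] [FiniteDimensional F₀ F] [Algebra.IsSeparable F₀ F]

instance : IsPrecomplete (IsLocalRing.maximalIdeal 𝒪[F₀]) 𝒪[F₀] :=
  let _ := IsTopologicalAddGroup.rightUniformSpace F₀
  have := isUniformAddGroup_of_addCommGroup (G := F₀)
  have : IsAdicComplete 𝓂[F₀] 𝒪[F₀] := inferInstance
  this.toIsPrecomplete

instance : FaithfulSMul 𝒪[F₀] (ringOfIntegers F₀ F) := by
  rw [faithfulSMul_iff_algebraMap_injective]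
  intro x y hxy
  have : algebraMap F₀ F x = algebraMap F₀ F y := congrArg Subtype.val hxy
  exact Subtype.ext ((algebraMap F₀ F).injective this)

instance : IsFractionRing (ringOfIntegers F₀ F) F :=
  integralClosure.isFractionRing_of_finite_extension F₀ F

instance : Module.Finite 𝒪[F₀] (ringOfIntegers F₀ F) := IsIntegralClosure.finite 𝒪[F₀] F₀ F _

instance : IsDedekindDomain (ringOfIntegers F₀ F) :=
  integralClosure.isDedekindDomain 𝒪[F₀] F₀ F

variable {B : Type v} [DivisionRing B] [Algebra F B]

/-- Locality comes from the uniformizer of `O` instead of uniqueness of the extended valuation; the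
Dedekind property does the rest. -/
theorem isDiscreteValuationRing_ringOfIntegers {O : Subalgebra (ringOfIntegers F₀ F) B}
    (hO : IsOrder F O) {π : ringOfIntegers F₀ F} (hπ : Irreducible π) {P : B}
    (hP : IsUniformizer O P) : IsDiscreteValuationRing (ringOfIntegers F₀ F) := by
  have : IsLocalRing (ringOfIntegers F₀ F) := isLocalRing_of_isUniformizer (F := F) hO hP
  have hfield : ¬ IsField (ringOfIntegers F₀ F) := fun h =>
    hπ.not_isUnit (by
      obtain ⟨y, hy⟩ := h.mul_inv_cancel hπ.ne_zero
      exact IsUnit.of_mul_eq_one y hy)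
  exact ((IsDiscreteValuationRing.TFAE (ringOfIntegers F₀ F) hfield).out 0 2 :
    IsDiscreteValuationRing _ ↔ IsDedekindDomain _).2 inferInstance

variable [Algebra.IsCentral F B]

theorem isLocalOrder_ringOfIntegers (h2 : (2 : F₀) ≠ 0) (hB : Module.finrank F B = 4)
    {O : Subalgebra (ringOfIntegers F₀ F) B} (hO : IsOrder F O)
    {π : ringOfIntegers F₀ F} (hπ : Irreducible π) {P : B} (hP : IsUniformizer O P)
    (hPπ : P * conj F P = algebraMap F B (π : F)) : IsLocalOrder F O P π := by
  have h2F : (2 : F) ≠ 0 := by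
    rw [← map_ofNat (algebraMap F₀ F) 2]
    exact (map_ne_zero _).2 h2
  have q : IsQuaternion F B := isQuaternion h2F hB
  have : IsDiscreteValuationRing (ringOfIntegers F₀ F) :=
    isDiscreteValuationRing_ringOfIntegers hO hπ hP
  have : Finite (IsLocalRing.ResidueField 𝒪[F₀]) := inferInstanceAs (Finite 𝓀[F₀])
  have : Algebra.IsIntegral 𝒪[F₀] (ringOfIntegers F₀ F) := Algebra.IsIntegral.of_finite _ _
  have : IsLocalHom (algebraMap 𝒪[F₀] (ringOfIntegers F₀ F)) :=
    Algebra.IsIntegral.isLocalHom _ _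
  have : Finite (IsLocalRing.ResidueField (ringOfIntegers F₀ F)) :=
    IsLocalRing.ResidueField.finite_of_finite (R := 𝒪[F₀]) inferInstance
  have hv : IsValuationOrder F O P π := isValuationOrder q hO hP hπ hPπ
  obtain ⟨ϖ, hϖ⟩ := IsDiscreteValuationRing.exists_irreducible 𝒪[F₀]
  have hϖ0 : algebraMap 𝒪[F₀] (ringOfIntegers F₀ F) ϖ ≠ 0 := by
    rw [Ne, FaithfulSMul.algebraMap_eq_zero_iff]
    exact hϖ.ne_zero
  obtain ⟨e, u, hu⟩ := IsDiscreteValuationRing.eq_unit_mul_pow_irreducible hϖ0 hπ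
  have he : π ^ e ∈ (IsLocalRing.maximalIdeal 𝒪[F₀]).map
      (algebraMap 𝒪[F₀] (ringOfIntegers F₀ F)) := by
    have : π ^ e = ↑u⁻¹ * algebraMap 𝒪[F₀] (ringOfIntegers F₀ F) ϖ := by
      rw [hu, Units.inv_mul_cancel_left]
    rw [this]
    refine Ideal.mul_mem_left _ _ (Ideal.mem_map_of_mem _ ?_)
    rw [IsLocalRing.mem_maximalIdeal]
    exact hϖ.not_isUnit
  exact isLocalOrder (exists_add_mul_sq_eq_of_isAdicComplete he) hv q hπ hO hB

end LocalField

/-- `h` is a hermitian form over `B` with respect to the canonical involution. -/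
structure IsHermitian (F : Type u) [Field F] {B : Type v} [DivisionRing B] [Algebra F B]
    {V : Type w} [AddCommGroup V] [Module B V] (h : V → V → B) : Prop where
  add_left : ∀ x y z, h (x + y) z = h x z + h y z
  smul_left : ∀ (a : B) x y, h (a • x) y = a * h x y
  conj_symm : ∀ x y, conj F (h x y) = h y x

/-! ### Hermitian forms for the canonical involution. -/

section Hermitian

variable {F : Type u} [Field F] {B : Type v} [DivisionRing B] [Algebra F B]
  {V : Type w} [AddCommGroup V] [Module B V] {h : V → V → B}

/-- The linear map `x ↦ h(x, y)`. -/
def IsHermitian.toLinearMap (hh : IsHermitian F h) (y : V) : V →ₗ[B] B where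
  toFun x := h x y
  map_add' x z := hh.add_left x z y
  map_smul' a x := hh.smul_left a x y

namespace IsHermitian

variable (hh : IsHermitian F h)
include hh

theorem zero_left (y : V) : h 0 y = 0 := (hh.toLinearMap y).map_zero

theorem sub_left (x z y : V) : h (x - z) y = h x y - h z y := (hh.toLinearMap y).map_sub x z

theorem sum_left {ι : Type*} (s : Finset ι) (f : ι → V) (y : V) :
    h (∑ i ∈ s, f i) y = ∑ i ∈ s, h (f i) y := map_sum (hh.toLinearMap y) f s

theorem add_right (x y z : V) : h x (y + z) = h x y + h x z := by
  rw [← hh.conj_symm, hh.add_left, conj_add, hh.conj_symm, hh.conj_symm]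

theorem sub_right (x y z : V) : h x (y - z) = h x y - h x z := by
  rw [← hh.conj_symm, hh.sub_left, conj_sub, hh.conj_symm, hh.conj_symm]

theorem sum_right {ι : Type*} (s : Finset ι) (x : V) (f : ι → V) :
    h x (∑ i ∈ s, f i) = ∑ i ∈ s, h x (f i) := by
  rw [← hh.conj_symm, hh.sum_left, conj_sum]
  simp only [hh.conj_symm]

theorem eq_zero_symm {x y : V} (hxy : h x y = 0) : h y x = 0 := by
  rw [← hh.conj_symm, hxy, conj_zero]

variable (q : IsQuaternion F B)
include q

theorem smul_right (a : B) (x y : V) : h x (a • y) = h x y * conj F a := by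
  rw [← hh.conj_symm, hh.smul_left, q.conj_mul, hh.conj_symm]

theorem exists_algebraMap_eq_self (x : V) : ∃ c : F, algebraMap F B c = h x x :=
  q.exists_algebraMap_eq_of_conj_eq (hh.conj_symm x x)

/-- Norm of a linear combination of two vectors. -/
theorem add_smul_self (x y : V) (a : B) : h (x + a • y) (x + a • y) =
    h x x + algebraMap F B (reducedTrace F (h x y * conj F a)) +
      algebraMap F B (reducedNorm F a) * h y y := by
  obtain ⟨c, hc⟩ := hh.exists_algebraMap_eq_self q y
  have e1 : h (a • y) x = conj F (h x y * conj F a) := by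
    rw [hh.smul_left, q.conj_mul, q.conj_conj, hh.conj_symm]
  rw [← add_conj, hh.add_left, hh.add_right, hh.add_right, hh.smul_right q, hh.smul_right q, e1,
    hh.smul_left, ← hc, ← Algebra.commutes, mul_assoc, q.mul_conj,
    ← Algebra.commutes (reducedNorm F a)]
  abel

end IsHermitian

/-! ### Splitting a form or lattice into equal orthogonal blocks. -/

section Gram

variable {κ : Type*} [Fintype κ] {G G' : Matrix κ κ B} {n : ℕ}

/-- The family `e` has block diagonal Gram matrix with all blocks equal to `G`. -/
def HasGram (h : V → V → B) (G : Matrix κ κ B) {n : ℕ} (e : Fin n × κ → V) : Prop :=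
  ∀ p q, h (e p) (e q) = if p.1 = q.1 then G p.2 q.2 else 0

variable {e : Fin n × κ → V}

theorem HasGram.apply_sum_smul (he : HasGram h G e) (hh : IsHermitian F h) (c : Fin n × κ → B)
    (j : Fin n) (b : κ) : h (∑ p, c p • e p) (e (j, b)) = ∑ a, c (j, a) * G a b := by
  rw [hh.sum_left, Fintype.sum_prod_type, Finset.sum_eq_single j]
  · refine Finset.sum_congr rfl fun a _ => ?_
    rw [hh.smul_left, he, if_pos rfl]
  · intro i _ hij
    refine Finset.sum_eq_zero fun a _ => ?_
    rw [hh.smul_left, he, if_neg hij, mul_zero]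
  · simp

variable [DecidableEq κ]

theorem HasGram.coeff_eq (he : HasGram h G e) (hh : IsHermitian F h) (hG : G * G' = 1)
    (c : Fin n × κ → B) (p : Fin n × κ) :
    ∑ b, h (∑ p, c p • e p) (e (p.1, b)) * G' b p.2 = c p := by
  have : ∀ b, h (∑ p, c p • e p) (e (p.1, b)) * G' b p.2 =
      ∑ a, c (p.1, a) * (G a b * G' b p.2) := fun b => by
    rw [he.apply_sum_smul hh, Finset.sum_mul]
    simp only [mul_assoc]
  simp only [this]
  rw [Finset.sum_comm]
  simp only [← Finset.mul_sum]
  have hG' (a : κ) : ∑ b, G a b * G' b p.2 = if a = p.2 then 1 else 0 := by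
    rw [← Matrix.mul_apply, hG, Matrix.one_apply]
  simp [hG']

theorem HasGram.linearIndependent (he : HasGram h G e) (hh : IsHermitian F h) (hG : G * G' = 1) :
    LinearIndependent B e := by
  rw [Fintype.linearIndependent_iff]
  intro c hc p
  rw [← he.coeff_eq hh hG c p, hc]
  simp [hh.zero_left]

theorem HasGram.repr_eq {f : Module.Basis (Fin n × κ) B V} (he : HasGram h G f)
    (hh : IsHermitian F h) (hG : G * G' = 1) (x : V) (p : Fin n × κ) :
    f.repr x p = ∑ b, h x (f (p.1, b)) * G' b p.2 := by
  rw [← he.coeff_eq hh hG (fun p => f.repr x p) p, f.sum_repr]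

omit [DecidableEq κ] in
theorem HasGram.apply_eq_sum (q : IsQuaternion F B) {f : Module.Basis (Fin n × κ) B V}
    (he : HasGram h G f) (hh : IsHermitian F h) (x y : V) : h x y =
      ∑ i, ∑ b, (∑ a, f.repr x (i, a) * G a b) * conj F (f.repr y (i, b)) := by
  conv_lhs => rw [← f.sum_repr y, hh.sum_right, Fintype.sum_prod_type]
  refine Finset.sum_congr rfl fun i _ => Finset.sum_congr rfl fun b _ => ?_
  rw [hh.smul_right q, ← he.apply_sum_smul hh (fun p => f.repr x p), f.sum_repr]

omit [DecidableEq κ] in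
/-- Forms with equal block diagonal Gram matrices are isometric. -/
theorem exists_isometry_of_hasGram [Nonempty κ] (q : IsQuaternion F B) {V' : Type*}
    [AddCommGroup V'] [Module B V'] {h' : V' → V' → B} (hh : IsHermitian F h)
    (hh' : IsHermitian F h') {n' : ℕ} {f : Module.Basis (Fin n × κ) B V}
    {f' : Module.Basis (Fin n' × κ) B V'} (hf : HasGram h G f) (hf' : HasGram h' G f')
    (hrank : Module.finrank B V = Module.finrank B V') :
    ∃ φ : V ≃ₗ[B] V', (∀ x y, h' (φ x) (φ y) = h x y) ∧
      ∀ (A : Set B) (x : V), (∀ p, f'.repr (φ x) p ∈ A) ↔ ∀ p, f.repr x p ∈ A := by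
  obtain rfl : n = n' := by
    rw [Module.finrank_eq_card_basis f, Module.finrank_eq_card_basis f', Fintype.card_prod,
      Fintype.card_prod, Fintype.card_fin, Fintype.card_fin] at hrank
    exact Nat.eq_of_mul_eq_mul_right Fintype.card_pos hrank
  have hrepr (x : V) : f'.repr (f.equiv f' (Equiv.refl _) x) = f.repr x := by
    simp [Module.Basis.equiv]
  refine ⟨f.equiv f' (Equiv.refl _), fun x y => ?_, fun A x => by rw [hrepr]⟩
  rw [hf'.apply_eq_sum q hh', hf.apply_eq_sum q hh, hrepr, hrepr]

/-- A submodule `W` splits off from `L` if every element of `L` has an orthogonal projection to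
`W` inside of `L`. -/
def Splits (h : V → V → B) (L : AddSubgroup V) (W : Submodule B V) : Prop :=
  ∀ y ∈ L, ∃ s ∈ L, s ∈ W ∧ ∀ w ∈ W, h (y - s) w = 0

/-- If the complement of every proper submodule that splits off contains a block with Gram matrix
`G`, then there is a basis with block diagonal Gram matrix. -/
theorem exists_basis_hasGram [Module.Finite B V] [Nonempty κ] (hh : IsHermitian F h)
    (hG : G * G' = 1) (A : Subring B) (L : AddSubgroup V)
    (hAL : ∀ a ∈ A, ∀ x ∈ L, a • x ∈ L) (hspan : Submodule.span B (L : Set V) = ⊤)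
    (hint : ∀ x ∈ L, ∀ y ∈ L, ∀ a b, h x y * G' a b ∈ A)
    (hext : ∀ W : Submodule B V, Splits h L W →
      (∃ z ∈ L, z ≠ 0 ∧ ∀ w ∈ W, h z w = 0) →
      ∃ e : κ → V, (∀ a, e a ∈ L) ∧ (∀ a, ∀ w ∈ W, h (e a) w = 0) ∧
        ∀ a b, h (e a) (e b) = G a b) :
    ∃ (n : ℕ) (f : Module.Basis (Fin n × κ) B V), HasGram h G f ∧
      ∀ x, x ∈ L ↔ ∀ p, f.repr x p ∈ A := by
  -- Take a maximal orthogonal family of blocks in `L`; linear independence bounds its length by the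
  -- rank.
  obtain ⟨n, ⟨e, heL, he⟩, hn⟩ : ∃ n : ℕ,
      (∃ e : Fin n × κ → V, (∀ p, e p ∈ L) ∧ HasGram h G e) ∧
      ¬ ∃ e : Fin (n + 1) × κ → V, (∀ p, e p ∈ L) ∧ HasGram h G e := by
    by_contra! H
    have hall (n : ℕ) : ∃ e : Fin n × κ → V, (∀ p, e p ∈ L) ∧ HasGram h G e := by
      induction n with
      | zero => exact ⟨fun p => p.1.elim0, fun p => p.1.elim0, fun p => p.1.elim0⟩
      | succ n ih => exact H n ih
    obtain ⟨e, -, he⟩ := hall (Module.finrank B V + 1)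
    have h1 := (he.linearIndependent hh hG).fintype_card_le_finrank
    rw [Fintype.card_prod, Fintype.card_fin] at h1
    have h2 : 0 < Fintype.card κ := Fintype.card_pos
    nlinarith
  have hproj (y : V) (hy : y ∈ L) : ∃ c : Fin n × κ → B, (∀ p, c p ∈ A) ∧
      ∀ p, h (y - ∑ p, c p • e p) (e p) = 0 := by
    -- The projection coefficients are products with the inverse Gram matrix, integral by `hint`.
    refine ⟨fun p => ∑ b, h y (e (p.1, b)) * G' b p.2,
      fun p => A.sum_mem fun b _ => hint y hy _ (heL _) _ _, fun p => ?_⟩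
    rw [hh.sub_left, he.apply_sum_smul hh, sub_eq_zero]
    simp only [Finset.sum_mul, mul_assoc]
    rw [Finset.sum_comm]
    simp only [← Finset.mul_sum]
    have hG' (b : κ) : ∑ a, G' b a * G a p.2 = if b = p.2 then 1 else 0 := by
      rw [← Matrix.mul_apply, mul_eq_one_comm.1 hG, Matrix.one_apply]
    simp [hG']
  have hsum (c : Fin n × κ → B) (hc : ∀ p, c p ∈ A) : ∑ p, c p • e p ∈ L :=
    L.sum_mem fun p _ => hAL _ (hc p) _ (heL p)
  have hsplit : Splits h L (Submodule.span B (Set.range e)) := by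
    intro y hy
    obtain ⟨c, hcA, hc⟩ := hproj y hy
    refine ⟨∑ p, c p • e p, hsum c hcA,
      Submodule.sum_mem _ fun p _ => Submodule.smul_mem _ _ (Submodule.subset_span ⟨p, rfl⟩),
      fun w hw => hh.eq_zero_symm ?_⟩
    have : Submodule.span B (Set.range e) ≤
        LinearMap.ker (hh.toLinearMap (y - ∑ p, c p • e p)) := by
      rw [Submodule.span_le]
      rintro _ ⟨p, rfl⟩
      exact hh.eq_zero_symm (hc p)
    exact this hw
  -- A nonzero orthogonal vector would provide one more block, against maximality.
  have hcompl (z : V) (hz : z ∈ L) (hze : ∀ p, h z (e p) = 0) : z = 0 := by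
    by_contra hz0
    refine hn ?_
    obtain ⟨e', he'L, he'W, he'⟩ := hext _ hsplit ⟨z, hz, hz0, fun w hw => hh.eq_zero_symm (by
      have : Submodule.span B (Set.range e) ≤ LinearMap.ker (hh.toLinearMap z) := by
        rw [Submodule.span_le]
        rintro _ ⟨p, rfl⟩
        exact hh.eq_zero_symm (hze p)
      exact this hw)⟩
    have he'e (a : κ) (p : Fin n × κ) : h (e' a) (e p) = 0 :=
      he'W a _ (Submodule.subset_span ⟨p, rfl⟩)
    let g : Fin (n + 1) → κ → V := Fin.cons e' fun i a => e (i, a)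
    refine ⟨fun p => g p.1 p.2, ?_, ?_⟩
    · rintro ⟨i, a⟩
      induction i using Fin.cases with
      | zero => exact he'L a
      | succ i => exact heL (i, a)
    · rintro ⟨i, a⟩ ⟨j, b⟩
      induction i using Fin.cases with
      | zero =>
        induction j using Fin.cases with
        | zero => simpa [g] using he' a b
        | succ j => simpa [g, (Fin.succ_ne_zero j).symm] using he'e a (j, b)
      | succ i =>
        induction j using Fin.cases with
        | zero => simpa [g] using hh.eq_zero_symm (he'e b (i, a))
        | succ j => simpa [g] using he (i, a) (j, b)
  have hLsum (y : V) (hy : y ∈ L) : ∃ c : Fin n × κ → B, (∀ p, c p ∈ A) ∧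
      y = ∑ p, c p • e p := by
    obtain ⟨c, hcA, hc⟩ := hproj y hy
    exact ⟨c, hcA, sub_eq_zero.1 (hcompl _ (L.sub_mem hy (hsum c hcA)) hc)⟩
  have htop : ⊤ ≤ Submodule.span B (Set.range e) := by
    rw [← hspan, Submodule.span_le]
    intro y hy
    obtain ⟨c, -, rfl⟩ := hLsum y hy
    exact Submodule.sum_mem _ fun p _ => Submodule.smul_mem _ _ (Submodule.subset_span ⟨p, rfl⟩)
  let f := Module.Basis.mk (he.linearIndependent hh hG) htop
  have hfe : ⇑f = e := Module.Basis.coe_mk _ _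
  refine ⟨n, f, by rw [hfe]; exact he, fun x => ⟨fun hx p => ?_, fun hx => ?_⟩⟩
  · obtain ⟨c, hcA, rfl⟩ := hLsum x hx
    rw [← hfe, f.repr_sum_self]
    exact hcA p
  · rw [← f.sum_repr x, hfe]
    exact hsum _ hx

end Gram

end Hermitian

/-! ### Exact orders, and surjectivity of norm and trace. -/

section Levels

variable {F : Type u} [Field F] {B : Type v} [DivisionRing B] [Algebra F B]
  {R : Type*} [CommRing R] [Algebra R F] [Algebra R B] {O : Subalgebra R B} {P : B} {π : R}

namespace IsValuationOrder

variable (hv : IsValuationOrder F O P π) (q : IsQuaternion F B) {m k : ℤ} {b d : B}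
include hv q

/-- The pair `InPow m d`, `InPow (-m) d⁻¹` is the form in which "order exactly `m`" is used
throughout. -/
theorem inPow_inv_of_not_inPow (h0 : InPow O P m d) (h1 : ¬ InPow O P (m + 1) d) :
    d ≠ 0 ∧ InPow O P (-m) d⁻¹ := by
  have hd : d ≠ 0 := by
    rintro rfl
    exact h1 inPow_zero_right
  obtain ⟨j, hj, hj'⟩ := hv.exists_inPow d hd
  have hjm : j ≤ m := by
    by_contra! hjm
    exact h1 (hv.inPow_mono q hjm hj)
  exact ⟨hd, hv.inPow_mono q (neg_le_neg hjm) hj'⟩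

theorem not_inPow_of_inPow_inv (hπ : ¬ IsUnit π) [FaithfulSMul R F] (hd : d ≠ 0)
    (h : InPow O P (-m) d⁻¹) : ¬ InPow O P (m + 1) d := by
  intro h'
  have h1 := hv.inPow_mul q h h'
  rw [inv_mul_cancel₀ hd, neg_add_cancel_left, hv.inPow_iff] at h1
  obtain ⟨r, hr⟩ := h1
  refine hπ (IsUnit.of_mul_eq_one r ?_)
  apply FaithfulSMul.algebraMap_injective R F
  rw [map_mul, hr, q.reducedNorm_one, mul_one, zpow_neg_one,
    mul_inv_cancel₀ (hv.algebraMap_ne_zero q), map_one]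

theorem eq_zero_of_forall_inPow (hπ : ¬ IsUnit π) [FaithfulSMul R F]
    (h : ∀ n : ℕ, InPow O P (m + n) d) : d = 0 := by
  by_contra hd
  obtain ⟨j, -, hj⟩ := hv.exists_inPow d hd
  refine hv.not_inPow_of_inPow_inv q hπ hd hj
    (hv.inPow_mono q (l := m + ((j + 1 - m).toNat : ℤ)) ?_ (h _))
  omega

theorem inPow_algebraMap_iff {c : F} : InPow O P (2 * k) (algebraMap F B c) ↔
    ∃ r : R, algebraMap R F r = algebraMap R F π ^ (-k) * c := by
  have h0 := hv.algebraMap_ne_zero q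
  rw [← hv.algebraMap_mem_iff, ← inPow_zero_iff (P := P), map_mul]
  have hx : algebraMap F B (algebraMap R F π ^ (-k)) ≠ 0 :=
    (map_ne_zero _).2 (zpow_ne_zero _ h0)
  have h1 := hv.inPow_mul_left_iff q (l := 2 * k) (b := algebraMap F B c) hx
    (hv.inPow_algebraMap_zpow q (-k)) (by
      have := hv.inPow_algebraMap_zpow q k
      rwa [zpow_neg, map_inv₀, inv_inv, mul_neg, neg_neg])
  rw [← h1, mul_neg, neg_add_cancel]

/-- Central elements have even order because `Nrd(c) = c²`. This separates the odd modular lattices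
from the even ones. -/
theorem inPow_algebraMap_of_odd [IsDomain R] [IsFractionRing R F] (hπ : Prime π) {c : F}
    (h : InPow O P (2 * k + 1) (algebraMap F B c)) :
    InPow O P (2 * (k + 1)) (algebraMap F B c) := by
  have h0 := hv.algebraMap_ne_zero q
  obtain ⟨r, hr⟩ := (hv.inPow_algebraMap_iff q).1 (hv.inPow_mono q (Int.le_add_one le_rfl) h)
  have h1 := hv.inPow_mul q (hv.inPow_algebraMap_zpow q (-k)) h
  rw [← map_mul, ← hr, mul_neg, neg_add_cancel_left,
    hv.inPow_iff_dvd q (r := r * r) (by rw [q.reducedNorm_algebraMap, map_mul])] at h1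
  obtain ⟨s, rfl⟩ : π ∣ r := (hπ.dvd_or_dvd h1).elim id id
  rw [hv.inPow_algebraMap_iff q]
  refine ⟨s, ?_⟩
  apply mul_left_cancel₀ h0
  rw [← map_mul, hr, ← mul_assoc, neg_add, zpow_add₀ h0, zpow_neg_one, mul_left_comm,
    mul_inv_cancel₀ h0, mul_one]

end IsValuationOrder

namespace IsLocalOrder

variable (hl : IsLocalOrder F O P π)
include hl

/-- The units of `R` and `π = Nrd(P)` are norms, and together they generate `F^×`. -/
theorem exists_reducedNorm_eq_of_ne_zero [IsDomain R] [IsDiscreteValuationRing R]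
    [IsFractionRing R F] (hπ : Irreducible π) {c : F} (hc : c ≠ 0) :
    ∃ b : B, reducedNorm F b = c := by
  have q := hl.isQuaternion
  have key (r : R) (hr : algebraMap R F r ≠ 0) : ∃ b : B, reducedNorm F b = algebraMap R F r := by
    have hr0 : r ≠ 0 := fun h => hr (by rw [h, map_zero])
    obtain ⟨n, u, rfl⟩ := IsDiscreteValuationRing.eq_unit_mul_pow_irreducible hr0 hπ
    obtain ⟨b, -, hb⟩ := hl.exists_reducedNorm_eq u u.isUnit
    refine ⟨b * P ^ (n : ℤ), ?_⟩
    rw [q.reducedNorm_mul, q.reducedNorm_zpow, hb, hl.reducedNorm_uniformizer, map_mul, map_pow,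
      zpow_natCast]
  obtain ⟨x, y, hy, rfl⟩ := IsFractionRing.div_surjective R c
  rw [div_ne_zero_iff] at hc
  obtain ⟨a, ha⟩ := key x hc.1
  obtain ⟨b, hb⟩ := key y hc.2
  refine ⟨a * b⁻¹, ?_⟩
  rw [q.reducedNorm_mul, q.reducedNorm_inv, ha, hb, div_eq_mul_inv]

/-- Solve `d ā = c w` with `w` integral of trace one; dividing by `d` lowers the order by exactly
`m`. -/
theorem exists_reducedTrace_mul_conj_eq {m j : ℤ} {d : B} (hd0 : d ≠ 0)
    (hd : InPow O P (-m) d⁻¹) {c : F} (hc : InPow O P (m + j) (algebraMap F B c)) :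
    ∃ a, InPow O P j a ∧ reducedTrace F (d * conj F a) = c := by
  have q := hl.isQuaternion
  obtain ⟨w, hw, hw1⟩ := hl.exists_reducedTrace_eq_one
  refine ⟨conj F (d⁻¹ * (algebraMap F B c * w)), hl.inPow_conj q ?_, ?_⟩
  · have := hl.inPow_mul q hd (hl.inPow_mul q hc (inPow_zero_iff.2 hw))
    rwa [add_zero, neg_add_cancel_left] at this
  · rw [q.conj_conj, mul_inv_cancel_left₀ hd0, ← Algebra.smul_def, reducedTrace_smul, hw1, mul_one]

end IsLocalOrder

end Levels

/-! ### Orthonormal bases and bases of modular lattices. -/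

section Extension

variable {F : Type u} [Field F] {B : Type v} [DivisionRing B] [Algebra F B]
  {R : Type*} [CommRing R] [IsDomain R] [IsDiscreteValuationRing R] [Algebra R F]
  [IsFractionRing R F] [Algebra R B] {O : Subalgebra R B} {P : B} {π : R}
  {V : Type w} [AddCommGroup V] [Module B V] {h : V → V → B}

/-- A non-degenerate hermitian form over a local quaternion division algebra has an orthonormal
basis. -/
theorem exists_orthonormal_basis [Module.Finite B V] (hl : IsLocalOrder F O P π)
    (hπ : Irreducible π) (hh : IsHermitian F h) (hnd : ∀ z, (∀ y, h z y = 0) → z = 0) :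
    ∃ (n : ℕ) (f : Module.Basis (Fin n × Unit) B V), HasGram h 1 f := by
  have q := hl.isQuaternion
  -- With the whole ring as coefficients and the whole space as lattice, the splitting procedure is
  -- ordinary diagonalization.
  refine (exists_basis_hasGram (G := (1 : Matrix Unit Unit B)) (G' := 1) hh
    (mul_one 1) ⊤ ⊤ (fun _ _ _ _ => trivial) (by simp) (fun _ _ _ _ _ _ => trivial) ?_).imp
    fun n ⟨f, hf, _⟩ => ⟨f, hf⟩
  rintro W hW ⟨z, -, hz0, hzW⟩
  obtain ⟨x, y, hx, hy, hxy⟩ : ∃ x y, (∀ w ∈ W, h x w = 0) ∧ (∀ w ∈ W, h y w = 0) ∧ h x y ≠ 0 := by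
    obtain ⟨y, hy⟩ : ∃ y, h z y ≠ 0 := by
      by_contra! H
      exact hz0 (hnd z H)
    obtain ⟨s, -, hsW, hs⟩ := hW y trivial
    exact ⟨z, y - s, hzW, hs, by rwa [hh.sub_right, hzW s hsW, sub_zero]⟩
  -- If all vectors orthogonal to `W` were isotropic, choosing `a` with `h(x,y) ā = 1` would give
  -- `h(x + ay, x + ay) = Trd(1) = 2`.
  obtain ⟨x, hx, hxx⟩ : ∃ x, (∀ w ∈ W, h x w = 0) ∧ h x x ≠ 0 := by
    by_contra! H
    have hsum : ∀ w ∈ W, h (x + (conj F (h x y))⁻¹ • y) w = 0 := fun w hw => by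
      rw [hh.add_left, hh.smul_left, hx w hw, hy w hw, mul_zero, add_zero]
    have := H _ hsum
    rw [hh.add_smul_self q, H x hx, H y hy, q.conj_inv, q.conj_conj, mul_inv_cancel₀ hxy,
      mul_zero, zero_add, add_zero, map_eq_zero] at this
    have h1 := q.reducedTrace_algebraMap 1
    rw [map_one, this, mul_one] at h1
    exact q.two_ne_zero h1.symm
  obtain ⟨c, hc⟩ := hh.exists_algebraMap_eq_self q x
  have hc0 : c ≠ 0 := by
    rintro rfl
    exact hxx (by rw [← hc, map_zero])
  obtain ⟨b, hb⟩ := hl.exists_reducedNorm_eq_of_ne_zero hπ (inv_ne_zero hc0)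
  refine ⟨fun _ => b • x, fun _ => trivial, fun _ w hw => ?_, fun _ _ => ?_⟩
  · rw [hh.smul_left, hx w hw, mul_zero]
  · rw [hh.smul_left, hh.smul_right q, ← hc, Algebra.commutes, ← mul_assoc, q.mul_conj, hb,
      ← map_mul, inv_mul_cancel₀ hc0, map_one, Matrix.one_apply, if_pos rfl]

/-- The lattice `L` is `P ^ m`-modular with respect to `h`. -/
def IsModular (h : V → V → B) (O : Subalgebra R B) (P : B) (m : ℤ) (L : AddSubgroup V) : Prop :=
  ∀ x, x ∈ L ↔ ∀ y ∈ L, InPow O P m (h x y)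

variable {m : ℤ} {L : AddSubgroup V}

-- Otherwise every `z ∈ L` orthogonal to `W` satisfies `h(z, L) ⊆ P^(m+1) O`, and modularity gives
-- `P⁻¹z ∈ L`. Iterating makes `h(z, L)` infinitely divisible, so `z = 0` by nondegeneracy.
omit [IsDomain R] [IsDiscreteValuationRing R] in
theorem IsModular.exists_not_inPow (hL : IsModular h O P m L) (hl : IsLocalOrder F O P π)
    (hπ : Irreducible π) (hh : IsHermitian F h) (hnd : ∀ z, (∀ y, h z y = 0) → z = 0)
    (hspan : Submodule.span B (L : Set V) = ⊤) {W : Submodule B V} (hW : Splits h L W)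
    (hz : ∃ z ∈ L, z ≠ 0 ∧ ∀ w ∈ W, h z w = 0) :
    ∃ x ∈ L, ∃ y ∈ L, (∀ w ∈ W, h x w = 0) ∧ (∀ w ∈ W, h y w = 0) ∧
      ¬ InPow O P (m + 1) (h x y) := by
  have q := hl.isQuaternion
  by_contra! H
  obtain ⟨z, hzL, hz0, hzW⟩ := hz
  have hstep (x : V) (hx : x ∈ L) (hxW : ∀ w ∈ W, h x w = 0) (y : V) (hy : y ∈ L) :
      InPow O P (m + 1) (h x y) := by
    obtain ⟨s, hsL, hsW, hs⟩ := hW y hy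
    have := H x hx (y - s) (L.sub_mem hy hsL) hxW hs
    rwa [hh.sub_right, hxW s hsW, sub_zero] at this
  have hP0 := hl.uniformizer_ne_zero
  have hdiv (n : ℕ) : (P ^ (-(n : ℤ))) • z ∈ L := by
    induction n with
    | zero => simpa using hzL
    | succ n ih =>
      rw [hL]
      intro y hy
      have h1 := hstep _ ih (fun w hw => by rw [hh.smul_left, hzW w hw, mul_zero]) y hy
      have h2 := hl.inPow_mul q (hl.inPow_zpow (-1)) h1
      rw [hh.smul_left] at h2 ⊢
      rw [← mul_assoc, ← zpow_add₀ hP0] at h2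
      rw [Nat.cast_succ, neg_add, add_comm (-(n : ℤ))]
      have e : -1 + (m + 1) = m := by ring
      rwa [e] at h2
  have hzero (y : V) (hy : y ∈ L) : h z y = 0 := by
    refine hl.eq_zero_of_forall_inPow q (m := m) hπ.not_isUnit fun n => ?_
    have h1 := hl.inPow_mul q (hl.inPow_zpow n) ((hL _).1 (hdiv n) y hy)
    rwa [hh.smul_left, ← mul_assoc, ← zpow_add₀ hP0, add_neg_cancel, zpow_zero, one_mul,
      add_comm] at h1
  refine hz0 (hnd z fun y => hh.eq_zero_symm ?_)
  have : Submodule.span B (L : Set V) ≤ LinearMap.ker (hh.toLinearMap z) := by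
    rw [Submodule.span_le]
    intro y hy
    exact hh.eq_zero_symm (hzero y hy)
  rw [hspan] at this
  exact this trivial

omit [IsDomain R] [IsDiscreteValuationRing R] [IsFractionRing R F] in
theorem IsModular.smul_mem (hL : IsModular h O P m L) (hh : IsHermitian F h)
    (hl : IsLocalOrder F O P π) {a : B} (ha : a ∈ O) {x : V} (hx : x ∈ L) : a • x ∈ L := by
  rw [hL] at hx ⊢
  intro y hy
  have := hl.inPow_mul hl.isQuaternion (inPow_zero_iff.2 ha) (hx y hy)
  rwa [zero_add, ← hh.smul_left] at this

theorem reducedNorm_smul_self (q : IsQuaternion F B) (hh : IsHermitian F h) (b : B) (x : V) :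
    h (b • x) (b • x) = algebraMap F B (reducedNorm F b) * h x x := by
  obtain ⟨c, hc⟩ := hh.exists_algebraMap_eq_self q x
  rw [hh.smul_left, hh.smul_right q, ← hc, ← mul_assoc, ← Algebra.commutes, mul_assoc, q.mul_conj,
    Algebra.commutes]

-- In even exponent a vector with self-product of exact order `2k` exists, and an element of unit
-- norm normalizes this product to `π^k`.
omit [IsDomain R] [IsDiscreteValuationRing R] in
theorem IsModular.exists_basis_of_even [Module.Finite B V] {k : ℤ}
    (hL : IsModular h O P (2 * k) L) (hl : IsLocalOrder F O P π)
    (hπ : Irreducible π) (hh : IsHermitian F h) (hnd : ∀ z, (∀ y, h z y = 0) → z = 0)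
    (hspan : Submodule.span B (L : Set V) = ⊤) :
    ∃ (n : ℕ) (f : Module.Basis (Fin n × Unit) B V),
      HasGram h (Matrix.of fun _ _ => algebraMap F B (algebraMap R F π ^ k)) f ∧
      ∀ x, x ∈ L ↔ ∀ p, f.repr x p ∈ O := by
  have q := hl.isQuaternion
  have hπ0 := hl.algebraMap_ne_zero q
  have hπk0 : algebraMap R F π ^ k ≠ 0 := zpow_ne_zero _ hπ0
  have hinj := IsFractionRing.injective R F
  refine exists_basis_hasGram (G' := Matrix.of fun _ _ => algebraMap F B (algebraMap R F π ^ (-k))) hh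
    ?_ O.toSubring L (fun a ha x hx => hL.smul_mem hh hl ha hx) hspan ?_ ?_
  · ext i j
    simp only [Matrix.mul_apply, Matrix.of_apply, Finset.univ_unique, Finset.sum_singleton]
    rw [← map_mul, ← zpow_add₀ hπ0, add_neg_cancel, zpow_zero, map_one]
    rfl
  · intro x hx y hy _ _
    have := hl.inPow_mul q ((hL x).1 hx y hy) (hl.inPow_algebraMap_zpow q (-k))
    rw [mul_neg, add_neg_cancel, inPow_zero_iff] at this
    exact this
  intro W hW hz
  obtain ⟨x, hx, y, hy, hxW, hyW, hxy⟩ := hL.exists_not_inPow hl hπ hh hnd hspan hW hz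
  have hLL (x : V) (hx : x ∈ L) (y : V) (hy : y ∈ L) := (hL x).1 hx y hy
  obtain ⟨x, hx, hxW, hxx⟩ : ∃ x ∈ L, (∀ w ∈ W, h x w = 0) ∧
      ¬ InPow O P (2 * k + 1) (h x x) := by
    by_contra! H
    obtain ⟨hd0, hd⟩ := hl.inPow_inv_of_not_inPow q (hLL x hx y hy) hxy
    -- The cross term of `h(x + ay, x + ay)` is made equal to `π^k`. If all self-products had order
    -- above `2k`, so would `π^k`.
    obtain ⟨a, ha, haT⟩ := hl.exists_reducedTrace_mul_conj_eq hd0 hd (j := 0)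
      (by rw [add_zero]; exact hl.inPow_algebraMap_zpow q k)
    rw [inPow_zero_iff] at ha
    have h1 := H _ (L.add_mem hx (hL.smul_mem hh hl ha hy)) (fun w hw => by
      rw [hh.add_left, hh.smul_left, hxW w hw, hyW w hw, mul_zero, add_zero])
    rw [hh.add_smul_self q, haT] at h1
    have h2 : InPow O P (2 * k + 1) (algebraMap F B (reducedNorm F a) * h y y) := by
      have := hl.inPow_mul q (inPow_zero_iff.2 ha) (hl.inPow_mul q (H y hy hyW)
        (inPow_zero_iff.2 (hl.conj_mem _ ha)))
      rwa [zero_add, add_zero, ← hh.smul_right q, ← hh.smul_left, reducedNorm_smul_self q hh]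
        at this
    have h3 := (h1.add h2.neg).add (H x hx hxW).neg
    have e : h x x + algebraMap F B (algebraMap R F π ^ k) +
        algebraMap F B (reducedNorm F a) * h y y +
        -(algebraMap F B (reducedNorm F a) * h y y) + -h x x =
        algebraMap F B (algebraMap R F π ^ k) := by abel
    rw [e] at h3
    refine hl.not_inPow_of_inPow_inv q hπ.not_isUnit ((map_ne_zero _).2 hπk0) ?_ h3
    rw [← map_inv₀, ← zpow_neg, ← mul_neg]
    exact hl.inPow_algebraMap_zpow q (-k)
  obtain ⟨c, hc⟩ := hh.exists_algebraMap_eq_self q x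
  obtain ⟨hc0, hci⟩ := hl.inPow_inv_of_not_inPow q (hLL x hx x hx) hxx
  have hcL := hLL x hx x hx
  rw [← hc] at hcL hci hc0
  rw [map_ne_zero] at hc0
  obtain ⟨r, hr⟩ := (hl.inPow_algebraMap_iff q).1 hcL
  rw [← map_inv₀, ← mul_neg, hl.inPow_algebraMap_iff q, neg_neg] at hci
  obtain ⟨s, hs⟩ := hci
  have hsr : s * r = 1 := by
    apply hinj
    rw [map_mul, hr, hs, map_one, zpow_neg]
    field_simp
  obtain ⟨b, hb, hbs⟩ := hl.exists_reducedNorm_eq s (IsUnit.of_mul_eq_one r hsr)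
  refine ⟨fun _ => b • x, fun _ => hL.smul_mem hh hl hb hx, fun _ w hw => ?_, fun _ _ => ?_⟩
  · rw [hh.smul_left, hxW w hw, mul_zero]
  · rw [reducedNorm_smul_self q hh, ← hc, ← map_mul, hbs, hs, mul_assoc, inv_mul_cancel₀ hc0,
      mul_one, Matrix.of_apply]

/-- The Gram matrix of a hyperbolic plane scaled by `c`. -/
noncomputable def hyperbolicGram (F : Type u) [Field F] {B : Type v} [DivisionRing B] [Algebra F B]
    (c : B) : Matrix Bool Bool B :=
  Matrix.of fun a b => if a = b then 0 else if a then conj F c else c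

/-- The inverse of the Gram matrix of a hyperbolic plane. -/
noncomputable def hyperbolicGramInv (F : Type u) [Field F] {B : Type v} [DivisionRing B]
    [Algebra F B] (c : B) : Matrix Bool Bool B :=
  Matrix.of fun a b => if a = b then 0 else if a then c⁻¹ else (conj F c)⁻¹

theorem hyperbolicGram_mul_inv (q : IsQuaternion F B) {c : B} (hc : c ≠ 0) :
    hyperbolicGram F c * hyperbolicGramInv F c = 1 := by
  have hc' := q.conj_ne_zero hc
  ext a b
  cases a <;> cases b <;>
    simp [hyperbolicGram, hyperbolicGramInv, Matrix.mul_apply, hc, hc']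

omit [IsDomain R] [IsDiscreteValuationRing R] [IsFractionRing R F] in
theorem inPow_hyperbolicGram (hv : IsValuationOrder F O P π) (q : IsQuaternion F B) (a b : Bool) :
    InPow O P m (hyperbolicGram F (P ^ m) a b) := by
  cases a <;> cases b
  · exact inPow_zero_right
  · exact hv.inPow_zpow m
  · exact hv.inPow_conj q (hv.inPow_zpow m)
  · exact inPow_zero_right

omit [IsDomain R] [IsDiscreteValuationRing R] [IsFractionRing R F] in
theorem inPow_hyperbolicGramInv (hv : IsValuationOrder F O P π) (q : IsQuaternion F B)
    (a b : Bool) : InPow O P (-m) (hyperbolicGramInv F (P ^ m) a b) := by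
  have h1 : InPow O P (-m) (P ^ m)⁻¹ := by
    rw [← zpow_neg]; exact hv.inPow_zpow (-m)
  cases a <;> cases b
  · exact inPow_zero_right
  · change InPow O P (-m) (conj F (P ^ m))⁻¹
    rw [← q.conj_inv]
    exact hv.inPow_conj q h1
  · exact h1
  · exact inPow_zero_right

/-- Two vectors of a modular lattice of odd exponent whose product generates the scale can be
changed into an isotropic vector and a partner. -/
theorem IsModular.exists_isotropic {k : ℤ}
    (hL : IsModular h O P (2 * k + 1) L) (hl : IsLocalOrder F O P π)
    (hπ : Irreducible π) (hh : IsHermitian F h) {x y : V} (hx : x ∈ L) (hy : y ∈ L)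
    (hxy : ¬ InPow O P (2 * k + 1 + 1) (h x y)) :
    ∃ a ∈ O, h (x + a • y) (x + a • y) = 0 := by
  have q := hl.isQuaternion
  have hπ0 := hl.algebraMap_ne_zero q
  have hLL (x : V) (hx : x ∈ L) (y : V) (hy : y ∈ L) := (hL x).1 hx y hy
  obtain ⟨hd0, hd⟩ := hl.inPow_inv_of_not_inPow q (hLL x hx y hy) hxy
  obtain ⟨A, hA⟩ := hh.exists_algebraMap_eq_self q x
  obtain ⟨C, hC⟩ := hh.exists_algebraMap_eq_self q y
  -- Self-products are central, so their order is at least `2k + 2`, one more than modularity alone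
  -- gives.
  have hAL := hl.inPow_algebraMap_of_odd q hπ.prime (hA ▸ hLL x hx x hx)
  have hCL := hl.inPow_algebraMap_of_odd q hπ.prime (hC ▸ hLL y hy y hy)
  set c₀ : F := algebraMap R F π ^ (k + 1) with hc₀
  have hc₀0 : c₀ ≠ 0 := zpow_ne_zero _ hπ0
  have hc₀L : InPow O P (2 * (k + 1)) (algebraMap F B c₀) := hl.inPow_algebraMap_zpow q (k + 1)
  obtain ⟨b, hb, hbT⟩ := hl.exists_reducedTrace_mul_conj_eq (j := 1) hd0 hd (c := c₀)
    (by rwa [add_assoc, one_add_one_eq_two, ← mul_add_one])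
  obtain ⟨s, hs⟩ := (hl.inPow_algebraMap_iff q).1 hAL
  have hNC : InPow O P (2 * (k + 2)) (algebraMap F B (reducedNorm F b * C)) := by
    rw [map_mul, ← q.mul_conj]
    have := hl.inPow_mul q (hl.inPow_mul q hb (hl.inPow_conj q hb)) hCL
    have e : 1 + 1 + 2 * (k + 1) = 2 * (k + 2) := by ring
    rwa [e] at this
  obtain ⟨r, hr⟩ := (hl.inPow_algebraMap_iff q).1 hNC
  -- With `a = t b`, the self-product of `x + ay` is `π^(k+1) (s + t + π r t²)`. The extra `π` in
  -- front of `t²` comes from taking `b` in `P O`.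
  obtain ⟨t, ht⟩ := hl.exists_add_mul_sq_eq (-s) r
  refine ⟨algebraMap R F t • b, ?_, ?_⟩
  · rw [Algebra.smul_def]
    exact O.mul_mem ((hl.algebraMap_mem_iff _).2 ⟨t, rfl⟩)
      (inPow_zero_iff.1 (hl.inPow_mono q zero_le_one hb))
  rw [hh.add_smul_self q, conj_smul, mul_smul_comm, reducedTrace_smul, hbT, q.reducedNorm_smul,
    ← hA, ← hC, ← map_mul, ← map_add, ← map_add]
  have hA' : A = c₀ * algebraMap R F s := by
    rw [hs, hc₀, zpow_neg, mul_inv_cancel_left₀ hc₀0]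
  have hC' : reducedNorm F b * C = c₀ * (algebraMap R F π * algebraMap R F r) := by
    rw [hr, hc₀, ← mul_assoc, ← mul_assoc, ← zpow_add_one₀ hπ0, ← zpow_add₀ hπ0]
    have e : k + 1 + 1 + -(k + 2) = 0 := by ring
    rw [e, zpow_zero, one_mul]
  have ht' := congrArg (algebraMap R F) ht
  simp only [map_add, map_mul, map_pow, map_neg] at ht'
  rw [← map_zero (algebraMap F B)]
  congr 1
  linear_combination hA' + algebraMap R F t ^ 2 * hC' + c₀ * ht'

/-- From a pair `x, y` with `h(x,y)` of exact order `2k + 1`, first `x` and then `y` is made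
isotropic, so a hyperbolic plane splits off. -/
theorem IsModular.exists_basis_of_odd [Module.Finite B V] {k : ℤ}
    (hL : IsModular h O P (2 * k + 1) L) (hl : IsLocalOrder F O P π)
    (hπ : Irreducible π) (hh : IsHermitian F h) (hnd : ∀ z, (∀ y, h z y = 0) → z = 0)
    (hspan : Submodule.span B (L : Set V) = ⊤) :
    ∃ (n : ℕ) (f : Module.Basis (Fin n × Bool) B V),
      HasGram h (hyperbolicGram F (P ^ (2 * k + 1))) f ∧
      ∀ x, x ∈ L ↔ ∀ p, f.repr x p ∈ O := by
  have q := hl.isQuaternion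
  have hP0 := hl.uniformizer_ne_zero
  refine exists_basis_hasGram hh (hyperbolicGram_mul_inv q (zpow_ne_zero _ hP0)) O.toSubring L
    (fun a ha x hx => hL.smul_mem hh hl ha hx) hspan ?_ ?_
  · intro x hx y hy a b
    have := hl.inPow_mul q ((hL x).1 hx y hy)
      (inPow_hyperbolicGramInv (m := 2 * k + 1) hl.toIsValuationOrder q a b)
    rw [add_neg_cancel, inPow_zero_iff] at this
    exact this
  intro W hW hz
  have hLL (x : V) (hx : x ∈ L) (y : V) (hy : y ∈ L) := (hL x).1 hx y hy
  obtain ⟨x, hx, y, hy, hxW, hyW, hxy⟩ := hL.exists_not_inPow hl hπ hh hnd hspan hW hz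
  obtain ⟨x, hx, hxW, hxx, hxy⟩ : ∃ x ∈ L, (∀ w ∈ W, h x w = 0) ∧ h x x = 0 ∧
      ¬ InPow O P (2 * k + 1 + 1) (h x y) := by
    obtain ⟨a, ha, haxy⟩ := hL.exists_isotropic hl hπ hh hx hy hxy
    refine ⟨x + a • y, L.add_mem hx (hL.smul_mem hh hl ha hy), fun w hw => ?_, haxy, fun H => ?_⟩
    · rw [hh.add_left, hh.smul_left, hxW w hw, hyW w hw, mul_zero, add_zero]
    -- Replacing `x` by `x + ay` changes `h(x,y)` by `a h(y,y)`, of order at least `2k + 2`, so the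
    -- exact order survives.
    · obtain ⟨C, hC⟩ := hh.exists_algebraMap_eq_self q y
      have h1 := hl.inPow_algebraMap_of_odd q hπ.prime (hC ▸ hLL y hy y hy)
      have h2 := hl.inPow_mul q (inPow_zero_iff.2 ha) h1
      rw [zero_add, hC, ← hh.smul_left, mul_add_one, ← one_add_one_eq_two, ← add_assoc]
        at h2
      rw [hh.add_left] at H
      have h3 := H.add h2.neg
      rw [add_neg_cancel_right] at h3
      exact hxy h3
  obtain ⟨hd0, hd⟩ := hl.inPow_inv_of_not_inPow q (hLL x hx y hy) hxy
  obtain ⟨y, hy, hyW, hyy, hd0, hd⟩ : ∃ y ∈ L, (∀ w ∈ W, h y w = 0) ∧ h y y = 0 ∧ h x y ≠ 0 ∧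
      InPow O P (-(2 * k + 1)) (h x y)⁻¹ := by
    obtain ⟨C, hC⟩ := hh.exists_algebraMap_eq_self q y
    have hd' : InPow O P (-(2 * k + 1)) (h y x)⁻¹ := by
      rw [← hh.conj_symm, ← q.conj_inv]
      exact hl.inPow_conj q hd
    have hd0' : h y x ≠ 0 := fun H => hd0 (hh.eq_zero_symm H)
    -- As `x` is isotropic, the self-product of `y + ax` has no quadratic term in `a`; the trace
    -- term is chosen to cancel `h(y,y)`.
    obtain ⟨a, ha, haT⟩ := hl.exists_reducedTrace_mul_conj_eq (j := 0) hd0' hd' (c := -C) (by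
      rw [add_zero, map_neg, hC]
      exact (hLL y hy y hy).neg)
    rw [inPow_zero_iff] at ha
    have e : h x (y + a • x) = h x y := by
      rw [hh.add_right, hh.smul_right q, hxx, zero_mul, add_zero]
    refine ⟨y + a • x, L.add_mem hy (hL.smul_mem hh hl ha hx), fun w hw => ?_, ?_, ?_, ?_⟩
    · rw [hh.add_left, hh.smul_left, hxW w hw, hyW w hw, mul_zero, add_zero]
    · rw [hh.add_smul_self q, haT, hxx, mul_zero, add_zero, ← hC, ← map_add, add_neg_cancel,
        map_zero]
    · rwa [e]
    · rwa [e]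
  have hb : conj F ((h x y)⁻¹ * P ^ (2 * k + 1)) ∈ O := by
    have := hl.inPow_mul q hd (hl.inPow_zpow (2 * k + 1))
    rw [neg_add_cancel, inPow_zero_iff] at this
    exact hl.conj_mem _ this
  set b := conj F ((h x y)⁻¹ * P ^ (2 * k + 1)) with hbdef
  have hxb : h x (b • y) = P ^ (2 * k + 1) := by
    rw [hh.smul_right q, hbdef, q.conj_conj, mul_inv_cancel_left₀ hd0]
  refine ⟨fun i => if i then b • y else x, fun i => ?_, fun i w hw => ?_, fun i j => ?_⟩
  · cases i
    · exact hx
    · exact hL.smul_mem hh hl hb hy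
  · cases i
    · exact hxW w hw
    · change h (b • y) w = 0
      rw [hh.smul_left, hyW w hw, mul_zero]
  · cases i <;> cases j
    · exact hxx
    · exact hxb
    · change h (b • y) x = conj F (P ^ (2 * k + 1))
      rw [← hxb, hh.conj_symm]
    · change h (b • y) (b • y) = 0
      rw [hh.smul_left, hh.smul_right q, hyy, zero_mul, mul_zero]

end Extension

/-! ### Construction of modular lattices. -/

section Existence

variable {F : Type u} [Field F] {B : Type v} [DivisionRing B] [Algebra F B]
  {R : Type*} [CommRing R] [Algebra R F] [Algebra R B] {O : Subalgebra R B} {P : B} {π : R}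
  {V : Type w} [AddCommGroup V] [Module B V] {h : V → V → B}

theorem inPow_sum {ι : Type*} {s : Finset ι} {g : ι → B} {k : ℤ} (hg : ∀ i, InPow O P k (g i)) :
    InPow O P k (∑ i ∈ s, g i) :=
  Finset.sum_induction g (InPow O P k) (fun _ _ => InPow.add) inPow_zero_right fun i _ => hg i

/-- The additive subgroup underlying a lattice. -/
def latticeAddSubgroup (L : Submodule O V) : AddSubgroup V := L.toAddSubgroup

theorem exists_latticeEquiv {V' : Type*} [AddCommGroup V'] [Module B V'] (φ : V ≃ₗ[B] V')
    {L : Submodule O V} {L' : Submodule O V'} (hφ : ∀ x, φ x ∈ L' ↔ x ∈ L) :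
    ∃ ψ : L ≃ₗ[O] L', ∀ x : L, (ψ x : V') = φ x := by
  have hφ' (y : L') : φ.symm y ∈ L := (hφ _).1 (by rw [φ.apply_symm_apply]; exact y.2)
  exact ⟨{  toFun := fun x => ⟨φ x, (hφ x).2 x.2⟩
            map_add' := fun x y => Subtype.ext (map_add φ _ _)
            map_smul' := fun c x => Subtype.ext (map_smul φ (c : B) (x : V))
            invFun := fun y => ⟨φ.symm y, hφ' y⟩
            left_inv := fun x => Subtype.ext (φ.symm_apply_apply _)
            right_inv := fun y => Subtype.ext (φ.apply_symm_apply _) }, fun x => rfl⟩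

section Standard

variable {ι : Type*}

/-- The lattice of vectors with integral coordinates. -/
def standardLattice (O : Subalgebra R B) (f : Module.Basis ι B V) : Submodule O V where
  carrier := {x | ∀ p, f.repr x p ∈ O}
  add_mem' hx hy p := by
    rw [map_add]
    exact O.add_mem (hx p) (hy p)
  zero_mem' p := by
    rw [map_zero]
    exact O.zero_mem
  smul_mem' c x hx p := by
    rw [Subalgebra.smul_def, map_smul]
    exact O.mul_mem c.2 (hx p)

/-- The coordinates identify the standard lattice with a standard free module. -/
noncomputable def standardLatticeEquiv [Fintype ι] (f : Module.Basis ι B V) :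
    standardLattice O f ≃ₗ[O] (ι → O) where
  toFun x p := ⟨f.repr x p, x.2 p⟩
  map_add' x y := by ext p; simp
  map_smul' c x := by ext p; simp [Subalgebra.smul_def]
  invFun c := ⟨f.equivFun.symm fun p => c p, fun p => by
    rw [← f.equivFun_apply, LinearEquiv.apply_symm_apply]; exact (c p).2⟩
  left_inv x := by
    ext
    simp only
    exact f.equivFun.symm_apply_apply _
  right_inv c := by
    ext p
    simp only
    rw [← f.equivFun_apply, LinearEquiv.apply_symm_apply]

theorem basis_mem_standardLattice (f : Module.Basis ι B V) (p : ι) :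
    f p ∈ standardLattice O f := by
  classical
  intro j
  rw [f.repr_self, Finsupp.single_apply]
  split_ifs
  · exact O.one_mem
  · exact O.zero_mem

theorem span_standardLattice (f : Module.Basis ι B V) :
    Submodule.span B (standardLattice O f : Set V) = ⊤ := by
  rw [eq_top_iff, ← f.span_eq]
  refine Submodule.span_mono ?_
  rintro _ ⟨p, rfl⟩
  exact basis_mem_standardLattice f p

end Standard

variable {κ : Type*} [Fintype κ] [DecidableEq κ] {G G' : Matrix κ κ B} {n : ℕ} {m : ℤ}

/-- The bound on `G` gives one inclusion. The bound on `G⁻¹` gives the other, since coordinates are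
products with basis vectors times `G⁻¹`. -/
theorem isModular_standardLattice (hl : IsLocalOrder F O P π) (hh : IsHermitian F h)
    {f : Module.Basis (Fin n × κ) B V} (hf : HasGram h G f) (hGG' : G * G' = 1)
    (hG : ∀ a b, InPow O P m (G a b)) (hG' : ∀ a b, InPow O P (-m) (G' a b)) :
    IsModular h O P m (latticeAddSubgroup (standardLattice O f)) := by
  have q := hl.isQuaternion
  intro x
  constructor
  · intro hx y hy
    rw [hf.apply_eq_sum q hh]
    refine inPow_sum fun i => inPow_sum fun b => ?_
    have h1 : InPow O P m (∑ a, f.repr x (i, a) * G a b) := inPow_sum fun a => by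
      have := hl.inPow_mul q (inPow_zero_iff.2 (hx (i, a))) (hG a b)
      rwa [zero_add] at this
    have := hl.inPow_mul q h1 (inPow_zero_iff.2 (hl.conj_mem _ (hy (i, b))))
    rwa [add_zero] at this
  · intro H p
    rw [hf.repr_eq hh hGG', ← inPow_zero_iff (P := P)]
    refine inPow_sum fun b => ?_
    have := hl.inPow_mul q (H _ (basis_mem_standardLattice f (p.1, b))) (hG' b p.2)
    rwa [add_neg_cancel] at this

theorem exists_basis_coe_eq [Module.Finite B V] [Nonempty κ] (hh : IsHermitian F h)
    {e : Fin n × κ → V} (he : HasGram h G e) (hGG' : G * G' = 1)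
    (hn : n * Fintype.card κ = Module.finrank B V) :
    ∃ f : Module.Basis (Fin n × κ) B V, ⇑f = e := by
  -- Rank zero is separate: the basis construction from linear independence needs a nonempty index
  -- type.
  rcases isEmpty_or_nonempty (Fin n × κ) with hem | hem
  · have h0 : Module.finrank B V = 0 := by
      rw [← hn, ← Fintype.card_fin n, ← Fintype.card_prod, Fintype.card_eq_zero_iff]
      exact hem
    have := Module.finrank_zero_iff.1 h0
    exact ⟨Module.Basis.empty V, by ext p; exact hem.elim p⟩
  · exact ⟨basisOfLinearIndependentOfCardEqFinrank (he.linearIndependent hh hGG') (by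
      rw [← hn, Fintype.card_prod, Fintype.card_fin]),
      coe_basisOfLinearIndependentOfCardEqFinrank _ _⟩

theorem exists_basis_hasGram_even [Module.Finite B V] (hl : IsLocalOrder F O P π)
    (hh : IsHermitian F h) {f : Module.Basis (Fin n × Unit) B V} (hf : HasGram h 1 f) (k : ℤ) :
    ∃ g : Module.Basis (Fin n × Unit) B V,
      HasGram h (Matrix.of fun _ _ => algebraMap F B (algebraMap R F π ^ k)) g := by
  have q := hl.isQuaternion
  have hπ0 := hl.algebraMap_ne_zero q
  have he : HasGram h (Matrix.of fun _ _ : Unit => algebraMap F B (algebraMap R F π ^ k))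
      (fun p => P ^ k • f p) := by
    intro p p'
    rw [hh.smul_left, hh.smul_right q, hf p p']
    split_ifs
    · rw [Matrix.one_apply, if_pos rfl, one_mul, q.mul_conj, q.reducedNorm_zpow,
        hl.reducedNorm_uniformizer, Matrix.of_apply]
    · rw [zero_mul, mul_zero]
  obtain ⟨g, hg⟩ := exists_basis_coe_eq
    (G' := Matrix.of fun _ _ => algebraMap F B (algebraMap R F π ^ (-k))) hh he (by
      ext i j
      simp only [Matrix.mul_apply, Matrix.of_apply, Finset.univ_unique, Finset.sum_singleton]
      rw [← map_mul, ← zpow_add₀ hπ0, add_neg_cancel, zpow_zero, map_one]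
      rfl) (by
      rw [Module.finrank_eq_card_basis f, Fintype.card_prod, Fintype.card_fin])
  exact ⟨g, by rw [hg]; exact he⟩

/-- With `Nrd(a) = -1`, orthonormal `f₁, f₂` give isotropic vectors `f₁ ± a f₂` whose mutual product
is 2. Scaling one of them by the conjugate of `c/2` makes it `c`. -/
theorem exists_basis_hasGram_hyperbolic [Module.Finite B V] (hl : IsLocalOrder F O P π)
    (hh : IsHermitian F h) {r : ℕ} (hn : n = r + r)
    {f : Module.Basis (Fin n × Unit) B V} (hf : HasGram h 1 f) {c : B} (hc : c ≠ 0) :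
    ∃ g : Module.Basis (Fin r × Bool) B V, HasGram h (hyperbolicGram F c) g := by
  have q := hl.isQuaternion
  obtain ⟨a, -, ha⟩ := hl.exists_reducedNorm_eq (-1) isUnit_one.neg
  rw [map_neg, map_one] at ha
  have ha' := q.mul_conj a
  rw [ha, map_neg, map_one] at ha'
  have h2 : (2 : B) ≠ 0 := by
    rw [← map_ofNat (algebraMap F B) 2]
    exact (map_ne_zero _).2 q.two_ne_zero
  let ε : Fin r × Bool ≃ Fin n × Unit := Fintype.equivOfCardEq (by simp [hn]; omega)
  have hε (p p' : Fin r × Bool) : h (f (ε p)) (f (ε p')) = if p = p' then 1 else 0 := by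
    rw [hf, Matrix.one_apply, if_pos rfl]
    refine if_congr ?_ rfl rfl
    rw [← ε.injective.eq_iff (a := p)]
    exact ⟨fun h => Prod.ext h rfl, fun h => by rw [h]⟩
  let β : B := conj F (2⁻¹ * c)
  let e : Fin r × Bool → V := fun p =>
    if p.2 then β • (f (ε (p.1, false)) - a • f (ε (p.1, true)))
    else f (ε (p.1, false)) + a • f (ε (p.1, true))
  have hβ : conj F β + conj F β = c := by
    rw [← two_mul, q.conj_conj, mul_inv_cancel_left₀ h2]
  have hβ' : β + β = conj F c := by
    rw [← hβ, conj_add, q.conj_conj]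
  have ha'' (x : B) : a * (conj F a * x) = -x := by
    rw [← mul_assoc, ha', neg_one_mul]
  have he : HasGram h (hyperbolicGram F c) e := by
    rintro ⟨i, s⟩ ⟨j, t⟩
    by_cases hij : i = j
    · subst hij
      cases s <;> cases t <;>
        simp [e, hh.add_left, hh.sub_left, hh.add_right, hh.sub_right, hh.smul_left,
          hh.smul_right q, hε, hyperbolicGram, ha', ha'', hβ, hβ']
    · cases s <;> cases t <;>
        simp [e, hh.add_left, hh.sub_left, hh.add_right, hh.sub_right, hh.smul_left,
          hh.smul_right q, hε, hij]
  obtain ⟨g, hg⟩ := exists_basis_coe_eq hh he (hyperbolicGram_mul_inv q hc) (by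
    rw [Module.finrank_eq_card_basis f, Fintype.card_prod, Fintype.card_fin, hn]
    simp
    omega)
  exact ⟨g, by rw [hg]; exact he⟩

end Existence

/-! ### The trace form of `B` over `F₀`. -/

section TraceForm

variable {F₀ : Type u₀} [Field F₀] {F : Type u} [Field F] [Algebra F₀ F]
  {B : Type v} [DivisionRing B] [Algebra F B] [Algebra F₀ B] [IsScalarTower F₀ F B]

variable (F₀ F B) in
/-- The trace of `B` over `F₀`, the composition of the reduced trace and the trace of `F / F₀`. -/
noncomputable def totalTrace : B →ₗ[F₀] F₀ :=
  (Algebra.trace F₀ F) ∘ₗ (reducedTraceLinear F B).restrictScalars F₀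

theorem totalTrace_apply (b : B) :
    totalTrace F₀ F B b = Algebra.trace F₀ F (reducedTrace F b) := rfl

theorem totalTrace_mul_comm (a b : B) :
    totalTrace F₀ F B (a * b) = totalTrace F₀ F B (b * a) := by
  rw [totalTrace_apply, totalTrace_apply, reducedTrace_mul_comm]

variable [FiniteDimensional F₀ F] [Algebra.IsSeparable F₀ F]

omit [FiniteDimensional F₀ F] [Algebra.IsSeparable F₀ F] in
theorem totalTrace_conj (q : IsQuaternion F B) (b : B) :
    totalTrace F₀ F B (conj F b) = totalTrace F₀ F B b := by
  rw [totalTrace_apply, totalTrace_apply, q.reducedTrace_conj]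

/-- For `b ≠ 0` test against `(c/2) b⁻¹` with `Tr_{F/F₀}(c) = 1`; such `c` exists by separability.
-/
theorem eq_zero_of_totalTrace_mul_eq_zero (q : IsQuaternion F B) {b : B}
    (hb : ∀ a, totalTrace F₀ F B (a * b) = 0) : b = 0 := by
  by_contra hb0
  obtain ⟨c, hc⟩ := Algebra.trace_surjective F₀ F 1
  have h2 := q.two_ne_zero
  have := hb (algebraMap F B (c / 2) * b⁻¹)
  rw [inv_mul_cancel_right₀ hb0, totalTrace_apply, q.reducedTrace_algebraMap,
    mul_div_cancel₀ _ h2, hc] at this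
  exact one_ne_zero this

theorem totalTrace_left_cancel (q : IsQuaternion F B) {b c : B}
    (hb : ∀ a, totalTrace F₀ F B (a * b) = totalTrace F₀ F B (a * c)) : b = c := by
  rw [← sub_eq_zero]
  refine eq_zero_of_totalTrace_mul_eq_zero (F₀ := F₀) q fun a => ?_
  rw [mul_sub, map_sub, hb, sub_self]

theorem exists_totalTrace_eq [FiniteDimensional F B] (q : IsQuaternion F B) (l : B →ₗ[F₀] F₀) :
    ∃ b : B, ∀ a, l a = totalTrace F₀ F B (a * b) := by
  have : FiniteDimensional F₀ B := FiniteDimensional.trans F₀ F B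
  let T : B →ₗ[F₀] Module.Dual F₀ B := LinearMap.mk₂ F₀ (fun b a => totalTrace F₀ F B (a * b))
    (fun b c a => by rw [mul_add, map_add]) (fun r b a => by rw [mul_smul_comm, map_smul])
    (fun b a c => by rw [add_mul, map_add]) (fun r b a => by rw [smul_mul_assoc, map_smul])
  have hinj : Function.Injective T := by
    rw [← LinearMap.ker_eq_bot, LinearMap.ker_eq_bot']
    intro b hb
    exact eq_zero_of_totalTrace_mul_eq_zero (F₀ := F₀) q fun a => LinearMap.congr_fun hb a
  obtain ⟨b, hb⟩ := (LinearMap.injective_iff_surjective_of_finrank_eq_finrank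
    (Subspace.dual_finrank_eq).symm).1 hinj l
  exact ⟨b, fun a => (LinearMap.congr_fun hb a).symm⟩

end TraceForm

/-! ### Passage between skew-hermitian and hermitian forms. -/

namespace SkewHermitianModule

variable {F₀ : Type u₀} [Field F₀] {F : Type u} [Field F] [Algebra F₀ F] [FiniteDimensional F₀ F]
  [Algebra.IsSeparable F₀ F]
  {B : Type v} [DivisionRing B] [Algebra F B] [Algebra F₀ B] [IsScalarTower F₀ F B]
  {σ : B →ₗ[F] B} {γ : B}

theorem conj_eq_neg_of_represents (hγ : Represents σ γ) : conj F γ = -γ :=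
  eq_neg_of_add_eq_zero_left hγ.conj_add

/-- The hermitian form attached to an `F₀`-valued skew-hermitian form. -/
theorem exists_isHermitian [FiniteDimensional F B] (q : IsQuaternion F B) (hγ : Represents σ γ)
    (M : SkewHermitianModule.{u₀, u, v, w} F₀ σ) :
    ∃ h : M.V → M.V → B, IsHermitian F h ∧ (∀ z, (∀ y, h z y = 0) → z = 0) ∧
      ∀ x y, M.ψ x y = totalTrace F₀ F B (h x y * γ⁻¹) := by
  have hγ0 := hγ.ne_zero
  have hcγ := conj_eq_neg_of_represents hγ
  have hex (x y : M.V) : ∃ g : B, ∀ a : B, M.ψ (a • x) y = totalTrace F₀ F B (a * g) :=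
    exists_totalTrace_eq q ((M.ψ.flip y) ∘ₗ (LinearMap.toSpanSingleton B M.V x).restrictScalars F₀)
  -- Here `g(x,y)` represents the functional `a ↦ ψ(ax, y)`; the hermitian form is `gγ`.
  choose g hg using hex
  have hg1 (x y : M.V) : M.ψ x y = totalTrace F₀ F B (g x y) := by
    simpa using hg x y 1
  refine ⟨fun x y => g x y * γ, ⟨fun x y z => ?_, fun a x y => ?_, fun x y => ?_⟩, fun z hz => ?_,
    fun x y => by rw [mul_inv_cancel_right₀ hγ0, hg1]⟩
  · rw [← add_mul]
    congr 1
    refine totalTrace_left_cancel (F₀ := F₀) q fun a => ?_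
    rw [← hg, mul_add, map_add, ← hg, ← hg, smul_add, map_add, LinearMap.add_apply]
  · rw [← mul_assoc]
    congr 1
    refine totalTrace_left_cancel (F₀ := F₀) q fun b => ?_
    rw [← hg, ← mul_assoc, ← hg, mul_smul]
  · rw [q.conj_mul, hcγ, neg_mul]
    -- Skew symmetry and the adjoint rule give a twisted symmetry of `g`, which right multiplication
    -- by the skew element `γ` untwists.
    have key : g y x = -(γ * conj F (g x y) * γ⁻¹) := by
      refine totalTrace_left_cancel (F₀ := F₀) q fun a => ?_
      rw [← hg, M.adjoint, M.skew, hg, hγ.apply_eq, mul_neg, map_neg, neg_inj, ← totalTrace_conj q,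
        q.conj_mul, q.conj_mul, q.conj_mul, q.conj_conj, q.conj_inv, hcγ]
      simp only [inv_neg, neg_mul, mul_neg, neg_neg]
      rw [← mul_assoc, totalTrace_mul_comm, mul_assoc, mul_assoc]
    rw [key, neg_mul, inv_mul_cancel_right₀ hγ0]
  · refine M.nondegenerate.1 z fun y => ?_
    have := hz y
    rw [mul_eq_zero, or_iff_left hγ0] at this
    rw [hg1, this, map_zero]

/-- The skew-hermitian module attached to a hermitian form. -/
noncomputable def ofIsHermitian (q : IsQuaternion F B) (hγ : Represents σ γ)
    {V : Type w} [AddCommGroup V] [Module B V] [Module F₀ V] [IsScalarTower F₀ B V]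
    [Module.Finite B V] {h : V → V → B} (hh : IsHermitian F h)
    (hnd : ∀ z, (∀ y, h z y = 0) → z = 0) : SkewHermitianModule.{u₀, u, v, w} F₀ σ :=
  have hF₀ (c : F₀) (x y : V) : h (c • x) y = c • h x y := by
    rw [← algebraMap_smul B c x, hh.smul_left, Algebra.smul_def]
  have hF₀' (c : F₀) (x y : V) : h x (c • y) = c • h x y := by
    rw [← hh.conj_symm, hF₀, ← algebraMap_smul F c, conj_smul, hh.conj_symm, algebraMap_smul]
  let ψ : V →ₗ[F₀] V →ₗ[F₀] F₀ := LinearMap.mk₂ F₀ (fun x y => totalTrace F₀ F B (h x y * γ⁻¹))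
    (fun x z y => by rw [hh.add_left, add_mul, map_add])
    (fun c x y => by rw [hF₀, smul_mul_assoc, map_smul])
    (fun x y z => by rw [hh.add_right, add_mul, map_add])
    (fun c x y => by rw [hF₀', smul_mul_assoc, map_smul])
  have hψ (x y : V) : ψ x y = totalTrace F₀ F B (h x y * γ⁻¹) := rfl
  have hskew (x y : V) : ψ y x = - ψ x y := by
    rw [hψ, hψ, ← hh.conj_symm, ← totalTrace_conj q, q.conj_mul, q.conj_conj, q.conj_inv,
      conj_eq_neg_of_represents hγ, inv_neg, neg_mul, map_neg, totalTrace_mul_comm]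
  have hleft : ψ.SeparatingLeft := fun z hz => hnd z fun y => by
    have : h z y * γ⁻¹ = 0 := eq_zero_of_totalTrace_mul_eq_zero (F₀ := F₀) q fun a => by
      -- This multiple of `y` places `a` to the right of `γ⁻¹`, so the trace form tests `h(z,y) γ⁻¹`
      -- against every `a`.
      have := hz (conj F (γ⁻¹ * a * γ) • y)
      rw [hψ, hh.smul_right q, q.conj_conj] at this
      rw [totalTrace_mul_comm, ← this, mul_assoc (h z y), mul_assoc (h z y)]
      congr 2
      rw [mul_assoc _ γ, mul_inv_cancel₀ hγ.ne_zero, mul_one]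
    rw [mul_eq_zero] at this
    exact this.resolve_right (inv_ne_zero hγ.ne_zero)
  { V := V
    ψ := ψ
    nondegenerate := ⟨hleft, fun z hz => hleft z fun y => by rw [hskew, hz, neg_zero]⟩
    skew := hskew
    adjoint := fun a x y => by
      rw [hψ, hψ, hh.smul_left, hh.smul_right q, hγ.apply_eq, q.conj_mul, q.conj_mul, q.conj_conj,
        q.conj_inv, conj_eq_neg_of_represents hγ, inv_neg, mul_neg, mul_neg, neg_mul, neg_neg,
        mul_assoc (h x y), mul_assoc, mul_assoc, mul_assoc, mul_inv_cancel₀ hγ.ne_zero, mul_one,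
        totalTrace_mul_comm, mul_assoc] }

end SkewHermitianModule

/-! ### Duals with respect to the reduced trace. -/

section Duality

variable {F : Type u} [Field F] {B : Type v} [DivisionRing B] [Algebra F B]
  {R : Type*} [CommRing R] [IsDomain R] [Algebra R F] [IsFractionRing R F] [Algebra R B]
  {O : Subalgebra R B} {P : B} {π : R}

-- The admissible exponents form `Set.Iic k`, so the supremum is attained and is not the default
-- value 0 of an unbounded set.
omit [IsDomain R] in
theorem ord_eq (hv : IsValuationOrder F O P π) (q : IsQuaternion F B) (hπ : ¬ IsUnit π) {b : B}
    {k : ℤ} (hb : b ≠ 0) (h1 : InPow O P k b) (h2 : InPow O P (-k) b⁻¹) : ord O P b = k := by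
  have hP0 := hv.uniformizer_ne_zero
  have hset : {k : ℤ | ∃ c ∈ O, b = P ^ k * c} = Set.Iic k := by
    ext j
    have : (∃ c ∈ O, b = P ^ j * c) ↔ InPow O P j b := by
      refine ⟨?_, fun h => ⟨_, h, ?_⟩⟩
      · rintro ⟨c, hc, rfl⟩
        rwa [InPow, ← mul_assoc, ← zpow_add₀ hP0, neg_add_cancel, zpow_zero, one_mul]
      · rw [← mul_assoc, ← zpow_add₀ hP0, add_neg_cancel, zpow_zero, one_mul]
    rw [Set.mem_ofPred_eq, this, Set.mem_Iic]
    refine ⟨fun h => ?_, fun h => hv.inPow_mono q h h1⟩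
    by_contra! hj
    exact hv.not_inPow_of_inPow_inv q hπ hb h2 (hv.inPow_mono q hj h)
  rw [ord, hset, csSup_Iic]

/-- For `k = 0` this says that the `Trd`-dual of `O` is `P⁻¹ O`. Traces from `P^(2k-1) O` are
central, so their order rises to `2k`; an element of smaller order has `π^(k-1)` among its traces.
-/
theorem IsLocalOrder.forall_reducedTrace_mul_iff (hl : IsLocalOrder F O P π) (hπ : Prime π)
    {k : ℤ} {b : B} : (∀ c ∈ O, ∃ r : R,
      algebraMap R F r = algebraMap R F π ^ (-k) * reducedTrace F (b * c)) ↔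
      InPow O P (2 * k - 1) b := by
  have q := hl.isQuaternion
  have hπ0 := hl.algebraMap_ne_zero q
  constructor
  · intro H
    by_contra hb
    have hb0 : b ≠ 0 := by
      rintro rfl
      exact hb inPow_zero_right
    obtain ⟨j, hj, hj'⟩ := hl.exists_inPow b hb0
    have hjk : 0 ≤ 2 * k - 2 - j := by
      by_contra! hlt
      exact hb (hl.inPow_mono q (by omega) hj)
    obtain ⟨a, ha, haT⟩ := hl.exists_reducedTrace_mul_conj_eq (j := 2 * k - 2 - j) hb0 hj'
      (c := algebraMap R F π ^ (k - 1)) (by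
        have := hl.inPow_algebraMap_zpow q (k - 1)
        have e : j + (2 * k - 2 - j) = 2 * (k - 1) := by ring
        rwa [e])
    obtain ⟨r, hr⟩ := H _ (hl.conj_mem _ (inPow_zero_iff.1 (hl.inPow_mono q hjk ha)))
    rw [haT, ← zpow_add₀ hπ0, neg_add_eq_sub, sub_sub_cancel_left, zpow_neg_one] at hr
    refine hπ.not_isUnit (IsUnit.of_mul_eq_one r ?_)
    apply IsFractionRing.injective R F
    rw [map_mul, hr, mul_inv_cancel₀ hπ0, map_one]
  · intro hb c hc
    have h1 := hl.inPow_mul q hb (inPow_zero_iff.2 hc)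
    rw [add_zero] at h1
    have h2 := h1.add (hl.inPow_conj q h1)
    rw [add_conj] at h2
    have e : 2 * k - 1 = 2 * (k - 1) + 1 := by ring
    rw [e] at h2
    have h3 := hl.inPow_algebraMap_of_odd q hπ h2
    rw [sub_add_cancel] at h3
    exact (hl.inPow_algebraMap_iff q).1 h3

end Duality

/-! ### The inverse different, and self-duality as modularity. -/

section LocalField

variable {F₀ : Type u₀} [Field F₀] [ValuativeRel F₀] [TopologicalSpace F₀]
    [IsNonarchimedeanLocalField F₀]
    {F : Type u} [Field F] [Algebra F₀ F] [FiniteDimensional F₀ F] [Algebra.IsSeparable F₀ F]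

theorem exists_zpow_mul_unit {R : Type*} [CommRing R] [IsDomain R] [IsDiscreteValuationRing R]
    [Algebra R F] [IsFractionRing R F] {π : R} (hπ : Irreducible π) {c : F} (hc : c ≠ 0) :
    ∃ (k : ℤ) (u : Rˣ), c = algebraMap R F π ^ k * algebraMap R F u := by
  have hπ0 : algebraMap R F π ≠ 0 := by
    rw [Ne, map_eq_zero_iff _ (IsFractionRing.injective R F)]; exact hπ.ne_zero
  have key (r : R) (hr : algebraMap R F r ≠ 0) :
      ∃ (k : ℤ) (u : Rˣ), algebraMap R F r = algebraMap R F π ^ k * algebraMap R F u := by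
    have hr0 : r ≠ 0 := fun h => hr (by rw [h, map_zero])
    obtain ⟨n, u, rfl⟩ := IsDiscreteValuationRing.eq_unit_mul_pow_irreducible hr0 hπ
    exact ⟨n, u, by rw [map_mul, map_pow, zpow_natCast, mul_comm]⟩
  obtain ⟨x, y, hy, rfl⟩ := IsFractionRing.div_surjective R c
  rw [div_ne_zero_iff] at hc
  obtain ⟨k, u, hk⟩ := key x hc.1
  obtain ⟨l, v, hl⟩ := key y hc.2
  have hv : algebraMap R F v ≠ 0 := (v.isUnit.map (algebraMap R F)).ne_zero
  have hvi : algebraMap R F ↑v⁻¹ = (algebraMap R F v)⁻¹ := by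
    apply eq_inv_of_mul_eq_one_left
    rw [← map_mul, Units.inv_mul, map_one]
  refine ⟨k - l, u * v⁻¹, ?_⟩
  rw [hk, hl, zpow_sub₀ hπ0, Units.val_mul, map_mul, hvi]
  field_simp

/-- The inverse different is a fractional ideal. -/
theorem exists_trace_mem_iff [IsDiscreteValuationRing (ringOfIntegers F₀ F)]
    {π : ringOfIntegers F₀ F} (hπ : Irreducible π) :
    ∃ e : ℤ, ∀ x : F, (∀ r : ringOfIntegers F₀ F, Algebra.trace F₀ F (x * r) ∈ 𝒪[F₀]) ↔
      ∃ r : ringOfIntegers F₀ F, (r : F) = (π : F) ^ (-e) * x := by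
  have hπ0 : (π : F) ≠ 0 := fun h => hπ.ne_zero (Subtype.ext h)
  let D : F → Prop := fun x => ∀ r : ringOfIntegers F₀ F, Algebra.trace F₀ F (x * r) ∈ 𝒪[F₀]
  have hDmul (x : F) (hx : D x) (s : ringOfIntegers F₀ F) : D (x * s) := fun r => by
    have := hx (s * r)
    rwa [MulMemClass.coe_mul, ← mul_assoc] at this
  have hmono (j k : ℤ) (hjk : j ≤ k) (hj : D ((π : F) ^ j)) : D ((π : F) ^ k) := by
    obtain ⟨n, rfl⟩ := Int.le.dest hjk
    have := hDmul _ hj (π ^ n)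
    rwa [SubmonoidClass.coe_pow, ← zpow_natCast, ← zpow_add₀ hπ0] at this
  have hunit (k : ℤ) (u : (ringOfIntegers F₀ F)ˣ) :
      D ((π : F) ^ k * (u : ringOfIntegers F₀ F)) ↔ D ((π : F) ^ k) := by
    refine ⟨fun h => ?_, fun h => hDmul _ h _⟩
    have := hDmul _ h ↑u⁻¹
    rwa [mul_assoc, ← MulMemClass.coe_mul, Units.mul_inv, OneMemClass.coe_one, mul_one] at this
  have h0 : D ((π : F) ^ (0 : ℤ)) := fun r => by
    rw [zpow_zero, one_mul]
    have h1 : IsIntegral 𝒪[F₀] (Algebra.trace F₀ F (r : F)) := Algebra.isIntegral_trace r.2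
    obtain ⟨y, hy⟩ := IsIntegrallyClosed.isIntegral_iff.1 h1
    rw [← hy]
    exact y.2
  have hfac {x : F} (hx : x ≠ 0) := exists_zpow_mul_unit (R := ringOfIntegers F₀ F) hπ hx
  -- If the exponents were unbounded below, all traces to `F₀` would be integral, contradicting
  -- surjectivity of the trace. The least exponent is `e`.
  obtain ⟨e, he, hmin⟩ := Int.exists_least_of_bdd (P := fun k : ℤ => D ((π : F) ^ k)) (by
    by_contra! H
    have hall (x : F) : D x := by
      rcases eq_or_ne x 0 with rfl | hx
      · intro r
        rw [zero_mul, map_zero]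
        exact zero_mem _
      · obtain ⟨k, u, rfl⟩ := hfac hx
        obtain ⟨j, hj, hjk⟩ := H k
        exact (hunit k u).2 (hmono j k hjk.le hj)
    obtain ⟨ϖ, hϖ⟩ := IsDiscreteValuationRing.exists_irreducible 𝒪[F₀]
    have hϖ0 : (ϖ : F₀) ≠ 0 := fun h => hϖ.ne_zero (Subtype.ext h)
    obtain ⟨x, hx⟩ := Algebra.trace_surjective F₀ F (ϖ : F₀)⁻¹
    have h1 := hall x 1
    rw [OneMemClass.coe_one, mul_one, hx] at h1
    exact hϖ.not_isUnit (IsUnit.of_mul_eq_one ⟨_, h1⟩ (Subtype.ext (mul_inv_cancel₀ hϖ0))))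
    ⟨0, h0⟩
  refine ⟨e, fun x => ?_⟩
  rcases eq_or_ne x 0 with rfl | hx
  · refine ⟨fun _ => ⟨0, by rw [mul_zero]; rfl⟩, fun _ r => ?_⟩
    rw [zero_mul, map_zero]
    exact zero_mem _
  constructor
  · intro h
    obtain ⟨k, u, rfl⟩ := hfac hx
    obtain ⟨n, hn⟩ := Int.le.dest (hmin k ((hunit k u).1 h))
    refine ⟨π ^ n * u, ?_⟩
    change _ = _ * ((π : F) ^ k * (u : ringOfIntegers F₀ F))
    rw [← mul_assoc, ← zpow_add₀ hπ0, MulMemClass.coe_mul, SubmonoidClass.coe_pow, ← zpow_natCast]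
    congr 2
    omega
  · rintro ⟨r, hr⟩
    have := hDmul _ he r
    rwa [hr, zpow_neg, mul_inv_cancel_left₀ (zpow_ne_zero _ hπ0)] at this

variable {B : Type v} [DivisionRing B] [Algebra F B] [Algebra F₀ B] [IsScalarTower F₀ F B]

/-- The dual of the maximal order with respect to the trace form is an odd power of the maximal
ideal. -/
theorem exists_totalTrace_mem_iff {O : Subalgebra (ringOfIntegers F₀ F) B} {P : B}
    {π : ringOfIntegers F₀ F} [IsDiscreteValuationRing (ringOfIntegers F₀ F)] (hπ : Irreducible π)
    (hl : IsLocalOrder F O P π) :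
    ∃ e : ℤ, ∀ b : B, (∀ c ∈ O, totalTrace F₀ F B (b * c) ∈ 𝒪[F₀]) ↔
      InPow O P (2 * e - 1) b := by
  obtain ⟨e, he⟩ := exists_trace_mem_iff (F₀ := F₀) hπ
  refine ⟨e, fun b => ?_⟩
  rw [← hl.forall_reducedTrace_mul_iff hπ.prime]
  constructor
  · intro H c hc
    refine (he _).1 fun r => ?_
    -- Since `O` contains `O_F`, testing against `rc` for all `r` places `Trd(bc)` in the inverse
    -- different.
    have h1 : algebraMap F B r * c ∈ O := O.mul_mem
      ((hl.algebraMap_mem_iff _).2 ⟨r, rfl⟩) hc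
    have := H _ h1
    rwa [← mul_assoc, ← Algebra.commutes, mul_assoc, ← Algebra.smul_def, totalTrace_apply,
      reducedTrace_smul, mul_comm] at this
  · intro H c hc
    have := (he _).2 (H c hc) 1
    rwa [OneMemClass.coe_one, mul_one] at this

namespace SkewHermitianModule

variable {σ : B →ₗ[F] B} {γ : B} {O : Subalgebra (ringOfIntegers F₀ F) B} {P : B}
  {π : ringOfIntegers F₀ F}

omit [TopologicalSpace F₀] [IsNonarchimedeanLocalField F₀] [FiniteDimensional F₀ F]
  [Algebra.IsSeparable F₀ F] in
/-- Scaled self-dual lattices of a skew-hermitian form are modular lattices of the attached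
hermitian form. -/
theorem isScaledSelfDual_iff (hl : IsLocalOrder F O P π) {e g i : ℤ}
    (he : ∀ b : B, (∀ c ∈ O, totalTrace F₀ F B (b * c) ∈ 𝒪[F₀]) ↔ InPow O P (2 * e - 1) b)
    (hγ0 : γ ≠ 0) (hγ1 : InPow O P g γ) (hγ2 : InPow O P (-g) γ⁻¹)
    {M : SkewHermitianModule.{u₀, u, v, w} F₀ σ} {h : M.V → M.V → B} (hh : IsHermitian F h)
    (hψ : ∀ x y, M.ψ x y = totalTrace F₀ F B (h x y * γ⁻¹)) {L : Submodule O M.V} :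
    M.IsScaledSelfDual P i L ↔
      M.IsLattice L ∧ IsModular h O P (i + g + 2 * e - 1) (latticeAddSubgroup L) := by
  have q := hl.isQuaternion
  have hP0 := hl.uniformizer_ne_zero
  have hdual (x : M.V) : x ∈ M.dual L ↔ ∀ y ∈ L, InPow O P (g + (2 * e - 1)) (h x y) := by
    -- Integrality of `ψ(x, c̄y)` for all `c ∈ O` says that `γ⁻¹ h(x,y)` lies in the trace dual of
    -- `O`. The lattice is `O`-stable, so these vectors are all available.
    have hmem (y : M.V) : InPow O P (g + (2 * e - 1)) (h x y) ↔
        ∀ c ∈ O, totalTrace F₀ F B (h x (conj F c • y) * γ⁻¹) ∈ 𝒪[F₀] := by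
      have h1 := hl.inPow_mul_left_iff q (l := g + (2 * e - 1)) (b := h x y) (inv_ne_zero hγ0) hγ2
        (by rwa [inv_inv, neg_neg])
      rw [← h1, neg_add_cancel_left, ← he]
      refine forall₂_congr fun c _ => ?_
      rw [hh.smul_right q, q.conj_conj, totalTrace_mul_comm _ γ⁻¹, mul_assoc]
    simp only [dual, Set.mem_ofPred_eq, hψ]
    refine ⟨fun H y hy => (hmem y).2 fun c hc => H _ ?_, fun H y hy => ?_⟩
    · exact L.smul_mem ⟨conj F c, hl.conj_mem c hc⟩ hy
    · have := (hmem y).1 (H y hy) 1 O.one_mem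
      rwa [q.conj_one, one_smul] at this
  have himage (x : M.V) : x ∈ (fun x : M.V => P ^ i • x) '' M.dual L ↔
      ∀ y ∈ L, InPow O P (i + g + 2 * e - 1) (h x y) := by
    have h1 : x ∈ (fun x : M.V => P ^ i • x) '' M.dual L ↔ P ^ (-i) • x ∈ M.dual L := by
      constructor
      · rintro ⟨z, hz, rfl⟩
        simp only
        rwa [smul_smul, ← zpow_add₀ hP0, neg_add_cancel, zpow_zero, one_smul]
      · intro hx
        refine ⟨_, hx, ?_⟩
        simp only
        rw [smul_smul, ← zpow_add₀ hP0, add_neg_cancel, zpow_zero, one_smul]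
    rw [h1, hdual]
    refine forall₂_congr fun y _ => ?_
    rw [hh.smul_left]
    have h2 := hl.inPow_mul_left_iff q (l := i + g + 2 * e - 1) (b := h x y)
      (zpow_ne_zero (-i) hP0) (hl.inPow_zpow (-i)) (by
        rw [← zpow_neg]; exact hl.inPow_zpow _)
    rw [← h2]
    have e : -i + (i + g + 2 * e - 1) = g + (2 * e - 1) := by ring
    rw [e]
  have hset : (L : Set M.V) = (fun x : M.V => P ^ i • x) '' M.dual L ↔
      IsModular h O P (i + g + 2 * e - 1) (latticeAddSubgroup L) := by
    rw [Set.ext_iff]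
    exact forall_congr' fun x => by rw [himage]; rfl
  exact ⟨fun H => ⟨H.isLattice, hset.1 H.eq_dual⟩, fun H => ⟨H.1, hset.2 H.2⟩⟩

omit [TopologicalSpace F₀] [IsNonarchimedeanLocalField F₀] [FiniteDimensional F₀ F]
  [Algebra.IsSeparable F₀ F] [IsScalarTower F₀ F B] in
theorem isLattice_standardLattice {M : SkewHermitianModule.{u₀, u, v, w} F₀ σ} {ι : Type*}
    [Fintype ι] (f : Module.Basis ι B M.V) : M.IsLattice (standardLattice O f) where
  finite := Module.Finite.equiv (standardLatticeEquiv f).symm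
  free := Module.Free.of_equiv (standardLatticeEquiv f).symm
  span_eq_top := span_standardLattice f

end SkewHermitianModule

end LocalField

/-! ### Existence and uniqueness of modular lattices. -/

section Modular

variable {F : Type u} [Field F] {B : Type v} [DivisionRing B] [Algebra F B]
  {R : Type*} [CommRing R] [IsDomain R] [IsDiscreteValuationRing R] [Algebra R F]
  [IsFractionRing R F] [Algebra R B] {O : Subalgebra R B} {P : B} {π : R}
  {V : Type w} [AddCommGroup V] [Module B V] [Module.Finite B V] {h : V → V → B} {m : ℤ}
  {L : AddSubgroup V}

theorem IsModular.even_finrank_or_even (hL : IsModular h O P m L) (hl : IsLocalOrder F O P π)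
    (hπ : Irreducible π) (hh : IsHermitian F h) (hnd : ∀ z, (∀ y, h z y = 0) → z = 0)
    (hspan : Submodule.span B (L : Set V) = ⊤) : Even (Module.finrank B V) ∨ Even m := by
  rcases Int.even_or_odd m with hm | ⟨k, rfl⟩
  · exact Or.inr hm
  · obtain ⟨n, f, -⟩ := hL.exists_basis_of_odd hl hπ hh hnd hspan
    rw [Module.finrank_eq_card_basis f, Fintype.card_prod, Fintype.card_bool]
    exact Or.inl (even_two.mul_left _)

theorem exists_isModular_standardLattice (hl : IsLocalOrder F O P π) (hπ : Irreducible π)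
    (hh : IsHermitian F h) (hnd : ∀ z, (∀ y, h z y = 0) → z = 0)
    (hm : Even (Module.finrank B V) ∨ Even m) :
    ∃ (ι : Type) (_ : Fintype ι) (f : Module.Basis ι B V),
      IsModular h O P m (latticeAddSubgroup (standardLattice O f)) := by
  have q := hl.isQuaternion
  have hπ0 := hl.algebraMap_ne_zero q
  obtain ⟨n, f, hf⟩ := exists_orthonormal_basis hl hπ hh hnd
  rcases Int.even_or_odd' m with ⟨k, rfl | hk⟩
  · obtain ⟨g, hg⟩ := exists_basis_hasGram_even hl hh hf k
    refine ⟨_, inferInstance, g, isModular_standardLattice hl hh hg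
      (G' := Matrix.of fun _ _ => algebraMap F B (algebraMap R F π ^ (-k))) ?_
      (fun _ _ => hl.inPow_algebraMap_zpow q k) (fun _ _ => ?_)⟩
    · ext i j
      simp only [Matrix.mul_apply, Matrix.of_apply, Finset.univ_unique, Finset.sum_singleton]
      rw [← map_mul, ← zpow_add₀ hπ0, add_neg_cancel, zpow_zero, map_one]
      rfl
    · rw [← mul_neg]
      exact hl.inPow_algebraMap_zpow q (-k)
  · have hn : Even n := by
      have h1 := hm.resolve_right (Int.not_even_iff_odd.2 ⟨k, hk⟩)
      rwa [Module.finrank_eq_card_basis f, Fintype.card_prod, Fintype.card_fin,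
        Fintype.card_unit, mul_one] at h1
    obtain ⟨r, hr⟩ := hn
    obtain ⟨g, hg⟩ := exists_basis_hasGram_hyperbolic hl hh hr hf
      (zpow_ne_zero m hl.uniformizer_ne_zero)
    exact ⟨_, inferInstance, g, isModular_standardLattice hl hh hg
      (hyperbolicGram_mul_inv q (zpow_ne_zero m hl.uniformizer_ne_zero))
      (inPow_hyperbolicGram hl.toIsValuationOrder q)
      (inPow_hyperbolicGramInv hl.toIsValuationOrder q)⟩

/-- Modular lattices of the same scale and rank are isometric. -/
theorem IsModular.exists_isometry {V' : Type*} [AddCommGroup V'] [Module B V']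
    [Module.Finite B V'] {h' : V' → V' → B} {L' : AddSubgroup V'}
    (hl : IsLocalOrder F O P π) (hπ : Irreducible π)
    (hrank : Module.finrank B V = Module.finrank B V')
    (hL : IsModular h O P m L) (hh : IsHermitian F h) (hnd : ∀ z, (∀ y, h z y = 0) → z = 0)
    (hspan : Submodule.span B (L : Set V) = ⊤)
    (hL' : IsModular h' O P m L') (hh' : IsHermitian F h')
    (hnd' : ∀ z, (∀ y, h' z y = 0) → z = 0) (hspan' : Submodule.span B (L' : Set V') = ⊤) :
    ∃ φ : V ≃ₗ[B] V', (∀ x y, h' (φ x) (φ y) = h x y) ∧ ∀ x, φ x ∈ L' ↔ x ∈ L := by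
  have q := hl.isQuaternion
  rcases Int.even_or_odd' m with ⟨k, rfl | rfl⟩
  · obtain ⟨n, f, hf, hfL⟩ := hL.exists_basis_of_even hl hπ hh hnd hspan
    obtain ⟨n', f', hf', hfL'⟩ := hL'.exists_basis_of_even hl hπ hh' hnd' hspan'
    obtain ⟨φ, hφ, hA⟩ := exists_isometry_of_hasGram q hh hh' hf hf' hrank
    exact ⟨φ, hφ, fun x => by rw [hfL, hfL']; exact hA O x⟩
  · obtain ⟨n, f, hf, hfL⟩ := hL.exists_basis_of_odd hl hπ hh hnd hspan
    obtain ⟨n', f', hf', hfL'⟩ := hL'.exists_basis_of_odd hl hπ hh' hnd' hspan'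
    obtain ⟨φ, hφ, hA⟩ := exists_isometry_of_hasGram q hh hh' hf hf' hrank
    exact ⟨φ, hφ, fun x => by rw [hfL, hfL']; exact hA O x⟩

theorem isHermitian_standard (q : IsQuaternion F B) (n : ℕ) :
    IsHermitian F fun x y : Fin n → B => ∑ i, x i * conj F (y i) where
  add_left x y z := by simp only [Pi.add_apply, add_mul, Finset.sum_add_distrib]
  smul_left a x y := by simp only [Pi.smul_apply, smul_eq_mul, mul_assoc, Finset.mul_sum]
  conj_symm x y := by simp only [conj_sum, q.conj_mul, q.conj_conj]

end Modular

/-! ### The three assertions for skew-hermitian modules. -/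

namespace SkewHermitianModule

variable {F₀ : Type u₀} [Field F₀] [ValuativeRel F₀] [TopologicalSpace F₀]
    [IsNonarchimedeanLocalField F₀]
    {F : Type u} [Field F] [Algebra F₀ F] [FiniteDimensional F₀ F] [Algebra.IsSeparable F₀ F]
    {B : Type v} [DivisionRing B] [Algebra F B] [Algebra F₀ B] [IsScalarTower F₀ F B]
    [FiniteDimensional F B]
    {σ : B →ₗ[F] B} {γ : B} {O : Subalgebra (ringOfIntegers F₀ F) B} {P : B}
    {π : ringOfIntegers F₀ F}

omit [ValuativeRel F₀] [TopologicalSpace F₀] [IsNonarchimedeanLocalField F₀]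
  [FiniteDimensional F B] in
theorem exists_rank_eq (q : IsQuaternion F B) (hγ : Represents σ γ) (n : ℕ) :
    ∃ M : SkewHermitianModule.{u₀, u, v, v} F₀ σ, M.rank = n := by
  classical
  refine ⟨ofIsHermitian q hγ (isHermitian_standard q n) fun z hz => ?_,
    Module.finrank_fin_fun B⟩
  ext i
  have := hz (Pi.single i 1)
  rw [Finset.sum_eq_single i (fun j _ hj => by rw [Pi.single_eq_of_ne hj, conj_zero, mul_zero])
    (by simp), Pi.single_eq_same, q.conj_one, mul_one] at this
  exact this

variable [IsDiscreteValuationRing (ringOfIntegers F₀ F)]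

omit [TopologicalSpace F₀] [IsNonarchimedeanLocalField F₀] in
theorem isomorphic_of_rank_eq (hl : IsLocalOrder F O P π) (hπ : Irreducible π)
    (hγ : Represents σ γ) {M M' : SkewHermitianModule.{u₀, u, v, w} F₀ σ}
    (hrank : M.rank = M'.rank) : M.Isomorphic M' := by
  have q := hl.isQuaternion
  obtain ⟨h, hh, hnd, hψ⟩ := M.exists_isHermitian q hγ
  obtain ⟨h', hh', hnd', hψ'⟩ := M'.exists_isHermitian q hγ
  obtain ⟨n, f, hf⟩ := exists_orthonormal_basis hl hπ hh hnd
  obtain ⟨n', f', hf'⟩ := exists_orthonormal_basis hl hπ hh' hnd'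
  obtain ⟨φ, hφ, -⟩ := exists_isometry_of_hasGram q hh hh' hf hf' hrank
  exact ⟨φ, fun x y => by rw [hψ, hψ', hφ]⟩

theorem exists_isScaledSelfDual_iff (hl : IsLocalOrder F O P π) (hπ : Irreducible π)
    (hγ : Represents σ γ) (M : SkewHermitianModule.{u₀, u, v, w} F₀ σ) (i : ℤ) :
    (∃ L : Submodule O M.V, M.IsScaledSelfDual P i L) ↔
      (Even M.rank ∨ Odd (i + ord O P γ)) := by
  have q := hl.isQuaternion
  obtain ⟨h, hh, hnd, hψ⟩ := M.exists_isHermitian q hγ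
  obtain ⟨g, hγ1, hγ2⟩ := hl.exists_inPow γ hγ.ne_zero
  obtain ⟨e, he⟩ := exists_totalTrace_mem_iff hπ hl
  rw [ord_eq hl.toIsValuationOrder q hπ.not_isUnit hγ.ne_zero hγ1 hγ2]
  -- The exponent `2e - 1` of the trace dual is odd, which reverses parity.
  have hpar : Odd (i + g) ↔ Even (i + g + 2 * e - 1) := by
    rw [Int.odd_iff, Int.even_iff]
    omega
  rw [hpar]
  constructor
  · rintro ⟨L, hL⟩
    obtain ⟨hlat, hmod⟩ := (isScaledSelfDual_iff hl he hγ.ne_zero hγ1 hγ2 hh hψ).1 hL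
    exact hmod.even_finrank_or_even hl hπ hh hnd hlat.span_eq_top
  · intro hm
    obtain ⟨ι, _, f, hf⟩ := exists_isModular_standardLattice hl hπ hh hnd hm
    exact ⟨_, (isScaledSelfDual_iff hl he hγ.ne_zero hγ1 hγ2 hh hψ).2
      ⟨isLattice_standardLattice f, hf⟩⟩

theorem latticeIsomorphic_of_isScaledSelfDual (hl : IsLocalOrder F O P π) (hπ : Irreducible π)
    (hγ : Represents σ γ) {M M' : SkewHermitianModule.{u₀, u, v, w} F₀ σ}
    (hrank : M.rank = M'.rank) {i : ℤ} {L : Submodule O M.V} {L' : Submodule O M'.V}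
    (hL : M.IsScaledSelfDual P i L) (hL' : M'.IsScaledSelfDual P i L') :
    LatticeIsomorphic M M' L L' := by
  have q := hl.isQuaternion
  obtain ⟨h, hh, hnd, hψ⟩ := M.exists_isHermitian q hγ
  obtain ⟨h', hh', hnd', hψ'⟩ := M'.exists_isHermitian q hγ
  obtain ⟨g, hγ1, hγ2⟩ := hl.exists_inPow γ hγ.ne_zero
  obtain ⟨e, he⟩ := exists_totalTrace_mem_iff hπ hl
  obtain ⟨hlat, hmod⟩ := (isScaledSelfDual_iff hl he hγ.ne_zero hγ1 hγ2 hh hψ).1 hL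
  obtain ⟨hlat', hmod'⟩ := (isScaledSelfDual_iff hl he hγ.ne_zero hγ1 hγ2 hh' hψ').1 hL'
  obtain ⟨φ, hφ, hφL⟩ := IsModular.exists_isometry hl hπ hrank hmod hh hnd hlat.span_eq_top
    hmod' hh' hnd' hlat'.span_eq_top
  obtain ⟨ψ, hψφ⟩ := exists_latticeEquiv φ hφL
  exact ⟨ψ, fun x y => by rw [hψφ, hψφ, hψ, hψ', hφ]⟩

end SkewHermitianModule

end QuatLattice

theorem mainTheorem5
    -- a non-Archimedean local field of characteristic not two
    {F₀ : Type u₀} [Field F₀] [ValuativeRel F₀] [TopologicalSpace F₀]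
    [IsNonarchimedeanLocalField F₀] (h2 : (2 : F₀) ≠ 0)
    -- a finite separable extension
    {F : Type u} [Field F] [Algebra F₀ F] [FiniteDimensional F₀ F] [Algebra.IsSeparable F₀ F]
    -- a division quaternion algebra over `F`
    {B : Type v} [DivisionRing B] [Algebra F B] [Algebra.IsCentral F B]
    (hB : Module.finrank F B = 4) [Algebra F₀ B] [IsScalarTower F₀ F B]
    -- an orthogonal involution of the first kind and a maximal order that is stable under it
    (σ : B →ₗ[F] B) (hσ : QuatLattice.IsOrthogonalInvolution σ)
    (O_B : Subalgebra (QuatLattice.ringOfIntegers F₀ F) B)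
    (hO : QuatLattice.IsMaximalOrder F O_B) (hOσ : ∀ b ∈ O_B, σ b ∈ O_B)
    -- a uniformizer `P` of the order whose reduced norm is the chosen uniformizer of `F`
    (π : QuatLattice.ringOfIntegers F₀ F) (hπ : Irreducible π)
    (P : B) (hP : QuatLattice.IsUniformizer O_B P)
    (hPπ : P * QuatLattice.conj F P = algebraMap F B (π : F))
    (n : ℕ) (hn : 1 ≤ n) :
    -- there is a unique skew-Hermitian module of rank `n`
    ((∃ M : QuatLattice.SkewHermitianModule.{u₀, u, v, v} F₀ σ, M.rank = n) ∧
      ∀ M M' : QuatLattice.SkewHermitianModule.{u₀, u, v, v} F₀ σ,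
        M.rank = n → M'.rank = n → M.Isomorphic M') ∧
    ∀ i : ℤ,
      -- it contains a lattice `L` with `L = P ^ i L^∨` exactly in the stated cases
      (∀ γ : B, QuatLattice.Represents σ γ →
        ∀ M : QuatLattice.SkewHermitianModule.{u₀, u, v, v} F₀ σ, M.rank = n →
          ((∃ L : Submodule O_B M.V, M.IsScaledSelfDual P i L) ↔
            (Even n ∨ Odd (i + QuatLattice.ord O_B P γ)))) ∧
      -- any two such lattices of rank `n` are isomorphic
      (∀ M M' : QuatLattice.SkewHermitianModule.{u₀, u, v, v} F₀ σ, M.rank = n → M'.rank = n →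
        ∀ (L : Submodule O_B M.V) (L' : Submodule O_B M'.V),
          M.IsScaledSelfDual P i L → M'.IsScaledSelfDual P i L' →
            QuatLattice.SkewHermitianModule.LatticeIsomorphic M M' L L') := by
  have h2F : (2 : F) ≠ 0 := by
    rw [← map_ofNat (algebraMap F₀ F) 2]
    exact (map_ne_zero _).2 h2
  have hord : QuatLattice.IsOrder F O_B := hO.1
  have hl := QuatLattice.isLocalOrder_ringOfIntegers h2 hB hord hπ hP hPπ
  have := QuatLattice.isDiscreteValuationRing_ringOfIntegers hord hπ hP
  have : FiniteDimensional F B := FiniteDimensional.of_finrank_pos (by omega)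
  -- The assertions that do not mention `γ` still need one for the passage to hermitian forms; the
  -- lattice criterion uses its own `γ'`.
  obtain ⟨γ, hγ⟩ := (QuatLattice.isQuaternion h2F hB).exists_represents hB hσ
  refine ⟨⟨QuatLattice.SkewHermitianModule.exists_rank_eq hl.isQuaternion hγ n,
    fun M M' hM hM' => QuatLattice.SkewHermitianModule.isomorphic_of_rank_eq hl hπ hγ
      (hM.trans hM'.symm)⟩, fun i => ⟨fun γ' hγ' M hM => ?_, fun M M' hM hM' L L' hL hL' =>
    QuatLattice.SkewHermitianModule.latticeIsomorphic_of_isScaledSelfDual hl hπ hγ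
      (hM.trans hM'.symm) hL hL'⟩⟩
  rw [← hM]
  exact QuatLattice.SkewHermitianModule.exists_isScaledSelfDual_iff hl hπ hγ' M i
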